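/- Let $\mathfrak X=(X,\rho,\mu)$ be a metric measure space: $X$ is a nonempty set, $\rho$ a metric on $X$, and $\mu$ a measure on a $\sigma$-algebra containing all Borel sets of $X$; a set of measure zero is a measurable set $N$ with $\mu(N)=0$. The space is called complete if every subset of a set of measure zero is measurable. A differentiation basis $\mathcal B$ in $\mathfrak X$ assigns to every $x\in X$ a family $\mathcal B(x)$ of measurable sets $S$ with $x\in S$ and $0<\mu(S)<\infty$. A sequence $(S_n)$ contracts to $x$ if $S_n\in\mathcal B(x)$ for all $n$ and there are radii $r_n\to0$ with $S_n\subseteq B(x,r_n)$ for all $n$; it is required that for $\mu$-almost every $x$ (that is, for all $x$ outside some set of measure zero) there is a sequence contracting to $x$. For $p\in[1,\infty]$, $\mathcal B$ differentiates $L^p(\mathfrak X)$ if, for every measurable $f\colon X\to\mathbb R$ with $\|f\|_{L^p(\mathfrak X)}<\infty$, the set of those $x\in X$ for which the condition $$\lim_{n\to\infty}\frac1{\mu(S_n)}\int_{S_n}f\,d\mu=f(x)\quad\text{for every }(S_n)\text{ contracting to }x$$ fails is a set of measure zero (in particular, it is measurable). Let $\operatorname{diff}(\mathcal B)$ be the set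 of all $p\in[1,\infty]$ such that $\mathcal B$ differentiates $L^p(\mathfrak X)$. **Theorem.** Let $\mathcal B$ be a differentiation basis in $\mathfrak X$. If $\mathfrak X$ is complete, then, for some $p_0\in[1,\infty)$, one of the following six cases occurs: (C1) $\operatorname{diff}(\mathcal B)=\emptyset$; (C2) $\operatorname{diff}(\mathcal B)=\{\infty\}$; (C3) $\operatorname{diff}(\mathcal B)=[p_0,\infty]$; (C4) $\operatorname{diff}(\mathcal B)=(p_0,\infty]$; (C5) $\operatorname{diff}(\mathcal B)=[p_0,\infty)$; (C6) $\operatorname{diff}(\mathcal B)=(p_0,\infty)$. Moreover, if $X$ is a countable union of (possibly overlapping) open sets of finite measure, then, whether or not $\mathfrak X$ is complete, one of the cases (C1)–(C4) occurs for some $p_0\in[1,\infty)$. Conversely, fix $p_0\in[1,\infty)$ and $P\subseteq[1,\infty]$. If $P$ is one of the six sets $\emptyset$, $\{\infty\}$, $[p_0,\infty]$, $(p_0,\infty]$, $[p_0,\infty)$, $(p_0,\infty)$, then there are a complete metric measure space $\mathfrak X$ and a differentiation basis $\mathcal B$ in it with $\operatorname{diff}(\mathcal B)=P$. If $P$ is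 one of the first four of these sets, then there are such $\mathfrak X$ and $\mathcal B$ with, in addition, $\mu(X)<\infty$. -/

import Mathlib

open MeasureTheory Filter Topology
open scoped ENNReal

universe u

/-- A differentiation basis in a metric measure space `(X, ρ, μ)`. Here `μ` is defined on a
σ-algebra that may be larger than the Borel one. To every point `x` we attach a family `sets x` of
measurable sets of positive finite measure containing `x`; for almost every `x` there has to be a
sequence in `sets x` that contracts to `x`. -/
structure DifferentiationBasis {X : Type u} [MetricSpace X] [MeasurableSpace X]
    (μ : Measure X) where
  /-- the family `𝓑(x)` -/
  sets : X → Set (Set X)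
  measurableSet_of_mem : ∀ x, ∀ S ∈ sets x, MeasurableSet S
  mem_of_mem : ∀ x, ∀ S ∈ sets x, x ∈ S
  measure_pos_of_mem : ∀ x, ∀ S ∈ sets x, 0 < μ S
  measure_lt_top_of_mem : ∀ x, ∀ S ∈ sets x, μ S < ∞
  exists_contracting : ∀ᵐ x ∂μ, ∃ S : ℕ → Set X, (∀ n, S n ∈ sets x) ∧
    ∃ r : ℕ → ℝ, Tendsto r atTop (𝓝 0) ∧ ∀ n, S n ⊆ Metric.ball x (r n)

namespace DifferentiationBasis

variable {X : Type u} [MetricSpace X] [MeasurableSpace X] {μ : Measure X}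

/-- The sequence `S` contracts to `x`: all its terms belong to `𝓑(x)`, and they are contained in
balls centered at `x` whose radii tend to `0`. -/
def Contracts (B : DifferentiationBasis μ) (S : ℕ → Set X) (x : X) : Prop :=
  (∀ n, S n ∈ B.sets x) ∧
    ∃ r : ℕ → ℝ, Tendsto r atTop (𝓝 0) ∧ ∀ n, S n ⊆ Metric.ball x (r n)

/-- The averages of `f` along every sequence contracting to `x` converge to `f x`. -/
def DifferentiatesAt (B : DifferentiationBasis μ) (f : X → ℝ) (x : X) : Prop :=
  ∀ S : ℕ → Set X, B.Contracts S x →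
    Tendsto (fun n => ⨍ y in S n, f y ∂μ) atTop (𝓝 (f x))

/-- `B` differentiates `L^p`: for every measurable `f` with finite `L^p` norm, the set of points
at which differentiation fails is a set of measure zero. As is usual when the measure need not be
complete, a set of measure zero is by definition measurable; on a complete space the
measurability is automatic. -/
def Differentiates (B : DifferentiationBasis μ) (p : ℝ≥0∞) : Prop :=
  ∀ f : X → ℝ, Measurable f → eLpNorm f p μ < ∞ →
    MeasurableSet {x | ¬ B.DifferentiatesAt f x} ∧ μ {x | ¬ B.DifferentiatesAt f x} = 0

/-- The set of all exponents `p ∈ [1, ∞]` such that `B` differentiates `L^p`. -/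
def diff (B : DifferentiationBasis μ) : Set ℝ≥0∞ :=
  {p | 1 ≤ p ∧ B.Differentiates p}

end DifferentiationBasis

/-- `P` is one of `∅`, `{∞}`, `[p₀, ∞]`, `(p₀, ∞]`. -/
def HasOneOfFirstFourForms (p₀ : ℝ≥0∞) (P : Set ℝ≥0∞) : Prop :=
  P = ∅ ∨ P = {∞} ∨ P = Set.Icc p₀ ∞ ∨ P = Set.Ioc p₀ ∞

/-- `P` is one of `∅`, `{∞}`, `[p₀, ∞]`, `(p₀, ∞]`, `[p₀, ∞)`, `(p₀, ∞)`. -/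
def HasOneOfSixForms (p₀ : ℝ≥0∞) (P : Set ℝ≥0∞) : Prop :=
  P = ∅ ∨ P = {∞} ∨ P = Set.Icc p₀ ∞ ∨ P = Set.Ioc p₀ ∞ ∨ P = Set.Ico p₀ ∞ ∨ P = Set.Ioo p₀ ∞

/-!
**Upward closure.** If `f` is of class `L^q` with `q < ∞`, its truncations to the sets
`{1 / (k + 1) ≤ |f|}` live on sets of finite measure, hence lie in `L^p` for all `p ≤ q`, and they
converge to `f` uniformly. Uniform limits preserve differentiation outside a null set, which is
measurable if the space is complete; so the finite exponents in `diff` form an up-set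
(`DifferentiationBasis.mem_diff_of_le_of_isComplete`). If open sets `G n` of finite measure cover
the space, one uses `f` restricted to `G n` instead: near points of `G n` this does not change the
averages, it covers `q = ∞`, and the exceptional set is a countable union of measurable sets
(`DifferentiationBasis.mem_diff_of_le_of_cover`). The possible forms of `diff` follow.

**Examples.** All examples live in the plane (`AtomicExtension`). A complete measure space
`(L, ν)` is placed on the horizontal axis; above it there are `n + 2` atoms of mass `δ n * t n` at
height `1 / (n + 1)`. The basic sets around a point `x` of the axis are a *core* of mass `δ n` and
the upper atom of level `n` close to `x`. An average over such a set is essentially the average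
over the core plus `t n` times the value at the upper atom. When the cores differentiate
well, the question is whether `f (near n x) * t n` tends to `0`. It does for `f` of class `L^p` if
`t n ^ p ≤ δ n * t n`, since `∑ |f (near n x)| ^ p * (δ n * t n)` is finite
(`AtomicExtension.tendsto_near_of_ne_top`). It does not for the function with values `1 / t n` on
the upper atoms of level `n`, which lies in `L^p` if `∑ (n + 2) * δ n * t n ^ (1 - p)` is finite
(`AtomicExtension.not_differentiates_of_summable`). Powers of `2` for `δ n` and `t n`, with
exponents of order `n ^ 2`, put the threshold at any given `p₀`, on either side
(`Profile.Separates`).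

For spaces of finite measure, the axis carries completed Lebesgue measure on the unit interval and
the cores are intervals, which differentiate all integrable functions (`lebesgueModel`). To exclude
`∞`, the unit interval carries the measure which is `0` on countable and `∞` on uncountable sets,
and a core consists of a point and of an atom belonging to this point only (`discreteModel`). A
function of class `L^p` with `p < ∞` vanishes on the cores of all but countably many points of the
interval, so the cores differentiate it; but the indicator of all these private atoms is bounded and is not differentiated.
-/

/-! ### Upward closure of the set of exponents -/

section General

variable {X : Type u} [MeasurableSpace X] {μ : Measure X}

theorem integrableOn_of_eLpNorm_lt_top {f : X → ℝ} {p : ℝ≥0∞} {S : Set X} (hf : Measurable f)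
    (hp : 1 ≤ p) (hfp : eLpNorm f p μ < ∞) (hS : μ S < ∞) : IntegrableOn f S μ := by
  have : IsFiniteMeasure (μ.restrict S) := ⟨by simpa using hS⟩
  have h : MemLp f p μ := ⟨hf.aestronglyMeasurable, hfp⟩
  exact (h.restrict S).integrable hp

theorem eLpNorm_indicator_lt_top_of_le {f : X → ℝ} {p q : ℝ≥0∞} {A : Set X} (hf : Measurable f)
    (hpq : p ≤ q) (hfq : eLpNorm f q μ < ∞) (hA : MeasurableSet A) (hμA : μ A < ∞) :
    eLpNorm (A.indicator f) p μ < ∞ := by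
  have : IsFiniteMeasure (μ.restrict A) := ⟨by simpa using hμA⟩
  have h : MemLp f q μ := ⟨hf.aestronglyMeasurable, hfq⟩
  exact ((memLp_indicator_iff_restrict hA).2 ((h.restrict A).mono_exponent hpq)).2

theorem abs_setAverage_sub_setAverage_le {f g : X → ℝ} {S : Set X} {ε : ℝ}
    (hf : IntegrableOn f S μ) (hg : IntegrableOn g S μ)
    (h0 : 0 < μ S) (hS : μ S < ∞) (hfg : ∀ x, |f x - g x| ≤ ε) :
    |(⨍ y in S, f y ∂μ) - ⨍ y in S, g y ∂μ| ≤ ε := by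
  have hpos : 0 < μ.real S := ENNReal.toReal_pos h0.ne' hS.ne
  rw [setAverage_eq, setAverage_eq, ← smul_sub, ← integral_sub hf hg, smul_eq_mul, abs_mul,
    abs_of_pos (inv_pos.2 hpos), inv_mul_le_iff₀ hpos, mul_comm]
  exact norm_setIntegral_le_of_norm_le_const (f := fun x => f x - g x) hS fun x _ => hfg x

end General

namespace DifferentiationBasis

variable {X : Type u} [MetricSpace X] [MeasurableSpace X] {μ : Measure X}

/-- On a complete space the finite exponents in `diff` form an up-set: a function of class `L^q` is
the uniform limit of its truncations to the sets `{1 / (k + 1) ≤ |f|}`. These have finite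
measure, so the truncations lie in `L^p` for every `p ≤ q`. -/
theorem mem_diff_of_le_of_isComplete (B : DifferentiationBasis μ) (hμ : μ.IsComplete)
    {p q : ℝ≥0∞} (hp : p ∈ B.diff) (hpq : p ≤ q) (hq : q ≠ ∞) : q ∈ B.diff := by
  have hq1 : 1 ≤ q := hp.1.trans hpq
  refine ⟨hq1, fun f hf hfq => ?_⟩
  suffices h : μ {x | ¬ B.DifferentiatesAt f x} = 0 from ⟨hμ.out' _ h, h⟩
  set A : ℕ → Set X := fun k => {x | ENNReal.ofReal (1 / (k + 1 : ℝ)) ≤ ‖f x‖ₑ}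
  have hAm : ∀ k, MeasurableSet (A k) := fun k => measurableSet_le measurable_const hf.enorm
  have hAμ : ∀ k, μ (A k) < ∞ := by
    intro k
    have hc : ENNReal.ofReal (1 / (k + 1 : ℝ)) ≠ 0 := by
      simp only [ne_eq, ENNReal.ofReal_eq_zero, not_le]; positivity
    exact MemLp.meas_ge_lt_top'_enorm ⟨hf.aestronglyMeasurable, hfq⟩
      (zero_lt_one.trans_le hq1).ne' hq hc (by simp)
  have hg : ∀ k, Measurable ((A k).indicator f) := fun k => hf.indicator (hAm k)
  have hgp : ∀ k, eLpNorm ((A k).indicator f) p μ < ∞ := fun k =>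
    eLpNorm_indicator_lt_top_of_le hf hpq hfq (hAm k) (hAμ k)
  have hclose : ∀ k x, |f x - (A k).indicator f x| ≤ 1 / (k + 1 : ℝ) := by
    intro k x
    by_cases hx : x ∈ A k
    · simp only [Set.indicator_of_mem hx, sub_self, abs_zero]; positivity
    · simp only [Set.indicator_of_notMem hx, sub_zero]
      have : ‖f x‖ₑ < ENNReal.ofReal (1 / (k + 1 : ℝ)) := not_le.1 hx
      rw [← ofReal_norm, ENNReal.ofReal_lt_ofReal_iff (by positivity)] at this
      exact this.le
  refine measure_mono_null (t := ⋃ k, {x | ¬ B.DifferentiatesAt ((A k).indicator f) x}) ?_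
    (measure_iUnion_null fun k => (hp.2 _ (hg k) (hgp k)).2)
  intro x hx
  by_contra hcon
  simp only [Set.mem_iUnion, Set.mem_ofPred_eq, not_exists, not_not] at hcon
  refine hx fun S hS => ?_
  rw [Metric.tendsto_atTop]
  intro ε hε
  obtain ⟨k, hk⟩ := exists_nat_one_div_lt (show (0 : ℝ) < ε / 3 by positivity)
  obtain ⟨N, hN⟩ := Metric.tendsto_atTop.1 (hcon k S hS) (ε / 3) (by positivity)
  refine ⟨N, fun n hn => ?_⟩
  have hfin := B.measure_lt_top_of_mem x _ (hS.1 n)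
  have h1 := abs_setAverage_sub_setAverage_le
    (integrableOn_of_eLpNorm_lt_top hf hq1 hfq hfin)
    (integrableOn_of_eLpNorm_lt_top (hg k) hp.1 (hgp k) hfin)
    (B.measure_pos_of_mem x _ (hS.1 n)) hfin (hclose k)
  have h2 := hN n hn
  have h3 := hclose k x
  rw [Real.dist_eq] at h2 ⊢
  rw [abs_le] at h1 h3
  rw [abs_lt] at h2 ⊢
  constructor <;> linarith [h1.1, h1.2, h2.1, h2.2, h3.1, h3.2]

theorem Contracts.eventually_subset {B : DifferentiationBasis μ} {S : ℕ → Set X} {x : X}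
    (hS : B.Contracts S x) {G : Set X} (hG : IsOpen G) (hx : x ∈ G) : ∀ᶠ n in atTop, S n ⊆ G := by
  obtain ⟨r, hr, hSr⟩ := hS.2
  obtain ⟨ε, hε, hεG⟩ := Metric.isOpen_iff.1 hG x hx
  filter_upwards [hr.eventually (gt_mem_nhds hε)] with n hn
  exact (hSr n).trans ((Metric.ball_subset_ball hn.le).trans hεG)

theorem differentiatesAt_indicator_iff {B : DifferentiationBasis μ} {f : X → ℝ} {G : Set X}
    (hG : IsOpen G) {x : X} (hx : x ∈ G) :
    B.DifferentiatesAt (G.indicator f) x ↔ B.DifferentiatesAt f x := by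
  refine forall₂_congr fun S hS => ?_
  rw [Set.indicator_of_mem hx]
  refine tendsto_congr' ?_
  filter_upwards [hS.eventually_subset hG hx] with n hn
  rw [setAverage_eq, setAverage_eq]
  congr 1
  exact setIntegral_congr_fun (B.measurableSet_of_mem x _ (hS.1 n))
    fun y hy => Set.indicator_of_mem (hn hy) f

/-- If open sets of finite measure cover the space, differentiation is a local matter, and
locally `L^q` is contained in `L^p` for `p ≤ q`. No completeness is needed, since the exceptional
set is an explicit countable union of measurable sets. -/
theorem mem_diff_of_le_of_cover [OpensMeasurableSpace X] (B : DifferentiationBasis μ)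
    {G : ℕ → Set X} (hG : ∀ n, IsOpen (G n) ∧ μ (G n) < ∞) (hcover : ⋃ n, G n = Set.univ)
    {p q : ℝ≥0∞} (hp : p ∈ B.diff) (hpq : p ≤ q) : q ∈ B.diff := by
  refine ⟨hp.1.trans hpq, fun f hf hfq => ?_⟩
  have key : {x | ¬ B.DifferentiatesAt f x} =
      ⋃ n, G n ∩ {x | ¬ B.DifferentiatesAt ((G n).indicator f) x} := by
    ext x
    simp only [Set.mem_ofPred_eq, Set.mem_iUnion, Set.mem_inter_iff]
    constructor
    · intro hx
      obtain ⟨n, hn⟩ := Set.mem_iUnion.1 (hcover ▸ Set.mem_univ x)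
      exact ⟨n, hn, by rwa [differentiatesAt_indicator_iff (hG n).1 hn]⟩
    · rintro ⟨n, hn, hx⟩
      rwa [differentiatesAt_indicator_iff (hG n).1 hn] at hx
  have hn : ∀ n, _ := fun n => hp.2 _ (hf.indicator (hG n).1.measurableSet)
    (eLpNorm_indicator_lt_top_of_le hf hpq hfq (hG n).1.measurableSet (hG n).2)
  rw [key]
  exact ⟨MeasurableSet.iUnion fun n => (hG n).1.measurableSet.inter (hn n).1,
    measure_iUnion_null fun n => measure_mono_null Set.inter_subset_right (hn n).2⟩

end DifferentiationBasis

theorem exists_hasOneOfSixForms {P : Set ℝ≥0∞} (h1 : ∀ p ∈ P, 1 ≤ p)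
    (hP : ∀ p ∈ P, ∀ q, p ≤ q → q ≠ ∞ → q ∈ P) :
    ∃ p₀ : ℝ≥0∞, 1 ≤ p₀ ∧ p₀ < ∞ ∧ HasOneOfSixForms p₀ P := by
  by_cases hfin : ∃ p ∈ P, p ≠ ∞
  · obtain ⟨p, hp, hpt⟩ := hfin
    have hle : ∀ q ∈ P, sInf P ≤ q := fun q hq => sInf_le hq
    have hgt : ∀ q, sInf P < q → q ≠ ∞ → q ∈ P := fun q hq hqt => by
      obtain ⟨r, hr, hrq⟩ := sInf_lt_iff.1 hq
      exact hP r hr q hrq.le hqt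
    have hlt : sInf P < ∞ := (hle p hp).trans_lt hpt.lt_top
    refine ⟨sInf P, le_sInf h1, hlt, ?_⟩
    by_cases hi : sInf P ∈ P <;> by_cases ht : ∞ ∈ P
    · refine Or.inr (Or.inr (Or.inl (Set.ext fun q => ⟨fun hq => ⟨hle q hq, le_top⟩, fun hq => ?_⟩)))
      rcases eq_or_ne q ∞ with rfl | hqt
      · exact ht
      · exact hP _ hi q hq.1 hqt
    · refine Or.inr (Or.inr (Or.inr (Or.inr (Or.inl (Set.ext fun q =>
        ⟨fun hq => ⟨hle q hq, ?_⟩, fun hq => hP _ hi q hq.1 hq.2.ne⟩)))))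
      exact lt_top_iff_ne_top.2 fun h => ht (h ▸ hq)
    · refine Or.inr (Or.inr (Or.inr (Or.inl (Set.ext fun q =>
        ⟨fun hq => ⟨(hle q hq).lt_of_ne fun h => hi (h ▸ hq), le_top⟩, fun hq => ?_⟩))))
      rcases eq_or_ne q ∞ with rfl | hqt
      · exact ht
      · exact hgt q hq.1 hqt
    · refine Or.inr (Or.inr (Or.inr (Or.inr (Or.inr (Set.ext fun q =>
        ⟨fun hq => ⟨(hle q hq).lt_of_ne fun h => hi (h ▸ hq), ?_⟩, fun hq => hgt q hq.1 hq.2.ne⟩)))))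
      exact lt_top_iff_ne_top.2 fun h => ht (h ▸ hq)
  · push Not at hfin
    refine ⟨1, le_rfl, ENNReal.one_lt_top, ?_⟩
    rcases Set.subset_singleton_iff_eq.1 (show P ⊆ {∞} from hfin) with h | h
    · exact Or.inl h
    · exact Or.inr (Or.inl h)

theorem exists_hasOneOfFirstFourForms {P : Set ℝ≥0∞} (h1 : ∀ p ∈ P, 1 ≤ p)
    (hP : ∀ p ∈ P, ∀ q, p ≤ q → q ∈ P) :
    ∃ p₀ : ℝ≥0∞, 1 ≤ p₀ ∧ p₀ < ∞ ∧ HasOneOfFirstFourForms p₀ P := by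
  obtain ⟨p₀, h1, ht, h⟩ := exists_hasOneOfSixForms h1 fun p hp q hpq _ => hP p hp q hpq
  refine ⟨p₀, h1, ht, ?_⟩
  obtain ⟨r, hr₀, hr⟩ := exists_between ht
  -- a finite exponent in `P` forces `∞ ∈ P`
  rcases h with h | h | h | h | h | h
  · exact Or.inl h
  · exact Or.inr (Or.inl h)
  · exact Or.inr (Or.inr (Or.inl h))
  · exact Or.inr (Or.inr (Or.inr h))
  · have : ∞ ∈ P := hP r (h ▸ ⟨hr₀.le, hr⟩) _ le_top
    rw [h] at this
    exact absurd this.2 (lt_irrefl _)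
  · have : ∞ ∈ P := hP r (h ▸ ⟨hr₀, hr⟩) _ le_top
    rw [h] at this
    exact absurd this.2 (lt_irrefl _)

/-! ### A line with atoms attached above and below -/

/-- The data of an example. The measure space `(L, ν)` is placed on the horizontal axis of the
plane through `pos`. Above the axis there are `n + 2` atoms of mass `δ n * t n` at height
`1 / (n + 1)`, shared by all points of `L`; below it, every point of `L` has an atom of its own, of
mass `d n`, at height `-1 / (n + 1)`. Around `x` one has the small sets `J n x`. A set of the
differentiation basis consists of `J n x` and the lower atom, of total mass `δ n`, and of one upper
atom, so that `t n` is the share of the latter relative to the rest. -/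
structure AtomicExtension (L : Type) [MeasurableSpace L] where
  ν : Measure L
  pos : L → ℝ
  d : ℕ → NNReal
  J : ℕ → L → Set L
  δ : ℕ → ℝ
  t : ℕ → ℝ
  isComplete : ν.IsComplete
  ne_zero : ν ≠ 0
  measurable_pos : Measurable pos
  pos_injective : Function.Injective pos
  pos_mem : ∀ᵐ x ∂ν, pos x ∈ Set.Ioo (0 : ℝ) 1
  measurableSet_J : ∀ n x, MeasurableSet (J n x)
  mem_J : ∀ n x, x ∈ J n x
  abs_sub_le : ∀ n x, ∀ y ∈ J n x, |pos y - pos x| ≤ δ n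
  δ_pos : ∀ n, 0 < δ n
  δ_tendsto : Tendsto δ atTop (𝓝 0)
  t_nonneg : ∀ n, 0 ≤ t n
  t_le_one : ∀ n, t n ≤ 1
  mass : ∀ᵐ x ∂ν, ∀ᶠ n in atTop, ν (J n x) + d n = ENNReal.ofReal (δ n)

namespace AtomicExtension

variable {L : Type} [MeasurableSpace L] (M : AtomicExtension L)

/-- The plane with the sup metric; the parameter `M` only serves to select the `σ`-algebra. -/
def Plane (_M : AtomicExtension L) : Type := ℝ × ℝ

instance : MetricSpace M.Plane := inferInstanceAs (MetricSpace (ℝ × ℝ))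

instance : Nonempty M.Plane := inferInstanceAs (Nonempty (ℝ × ℝ))

/-- The inclusion of `L` as a part of the horizontal axis. -/
def base (x : L) : M.Plane := (M.pos x, (0 : ℝ))

/-- The `k`-th of the shared atoms at height `1 / (n + 1)`. -/
noncomputable def upper (i : Σ n : ℕ, Fin (n + 2)) : M.Plane :=
  (((i.2 : ℕ) : ℝ) / (i.1 + 1), (1 : ℝ) / (i.1 + 1))

/-- The private atom of the point `i.2` at height `-1 / (i.1 + 1)`. -/
noncomputable def lower (i : ℕ × L) : M.Plane := (M.pos i.2, -((1 : ℝ) / (i.1 + 1)))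

/-- A set is measurable if its trace on `L` is; there is no condition off the axis. -/
instance : MeasurableSpace M.Plane := MeasurableSpace.map M.base inferInstance

theorem measurableSet_iff {A : Set M.Plane} :
    MeasurableSet A ↔ MeasurableSet (M.base ⁻¹' A) := Iff.rfl

theorem measurable_base : Measurable M.base := fun _ hA => hA

theorem measurable_iff {α : Type*} [MeasurableSpace α] {f : M.Plane → α} :
    Measurable f ↔ Measurable (f ∘ M.base) := Iff.rfl

instance : OpensMeasurableSpace M.Plane := by
  refine ⟨MeasurableSpace.generateFrom_le fun G hG => ?_⟩
  have h : Continuous fun a : ℝ => ((a, (0 : ℝ)) : ℝ × ℝ) := by fun_prop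
  exact M.measurable_pos (h.isOpen_preimage G hG).measurableSet

/-- The mass of each atom at height `1 / (n + 1)`. -/
noncomputable def e (n : ℕ) : ℝ≥0∞ := ENNReal.ofReal (M.δ n * M.t n)

/-- The measure `ν` on the axis, together with all the atoms. -/
noncomputable def measure : Measure M.Plane :=
  Measure.map M.base M.ν + Measure.sum (fun i => M.e i.1 • Measure.dirac (M.upper i)) +
    Measure.sum (fun i => (M.d i.1 : ℝ≥0∞) • Measure.dirac (M.lower i))

theorem lintegral_measure {f : M.Plane → ℝ≥0∞} (hf : Measurable f) :
    ∫⁻ z, f z ∂M.measure = ∫⁻ x, f (M.base x) ∂M.ν + ∑' i, M.e i.1 * f (M.upper i) +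
      ∑' i, (M.d i.1 : ℝ≥0∞) * f (M.lower i) := by
  simp only [measure, lintegral_add_measure, lintegral_map hf M.measurable_base,
    lintegral_sum_measure, lintegral_smul_measure, lintegral_dirac, smul_eq_mul]

theorem measure_apply {A : Set M.Plane} (hA : MeasurableSet A) :
    M.measure A = M.ν (M.base ⁻¹' A) + ∑' i, M.e i.1 * A.indicator 1 (M.upper i) +
      ∑' i, (M.d i.1 : ℝ≥0∞) * A.indicator 1 (M.lower i) := by
  rw [← lintegral_indicator_one hA, M.lintegral_measure (measurable_one.indicator hA),
    ← lintegral_indicator_one (M.measurable_base hA)]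
  rfl

theorem measure_preimage_base_le (A : Set M.Plane) : M.ν (M.base ⁻¹' A) ≤ M.measure A := by
  refine (measure_mono (Set.preimage_mono (subset_toMeasurable M.measure A))).trans ?_
  rw [← measure_toMeasurable A, M.measure_apply (measurableSet_toMeasurable _ _), add_assoc]
  exact le_self_add

theorem measure_eq_zero {A : Set M.Plane} (h : M.ν (M.base ⁻¹' A) = 0)
    (hu : ∀ i, M.upper i ∈ A → M.e i.1 = 0) (hl : ∀ i, M.lower i ∈ A → M.d i.1 = 0) :
    M.measure A = 0 := by
  have hA : MeasurableSet A := M.isComplete.out' _ h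
  rw [M.measure_apply hA, h, zero_add, add_eq_zero, ENNReal.tsum_eq_zero, ENNReal.tsum_eq_zero]
  constructor <;> intro i
  · by_cases hi : M.upper i ∈ A
    · rw [hu i hi, zero_mul]
    · rw [Set.indicator_of_notMem hi, mul_zero]
  · by_cases hi : M.lower i ∈ A
    · rw [hl i hi, ENNReal.coe_zero, zero_mul]
    · rw [Set.indicator_of_notMem hi, mul_zero]

theorem isComplete_measure : M.measure.IsComplete :=
  ⟨fun A hA => M.isComplete.out' _ (nonpos_iff_eq_zero.1 (hA ▸ M.measure_preimage_base_le A))⟩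

theorem measure_univ_lt_top (hν : M.ν Set.univ < ∞) (hd : ∀ n, M.d n = 0)
    (hs : Summable fun n : ℕ => (n + 2) * (M.δ n * M.t n)) : M.measure Set.univ < ∞ := by
  rw [M.measure_apply MeasurableSet.univ]
  have h0 : ∀ n, 0 ≤ M.δ n * M.t n := fun n => mul_nonneg (M.δ_pos n).le (M.t_nonneg n)
  have h : ∑' n : ℕ, (n + 2 : ℝ≥0∞) * M.e n ≠ ∞ := by
    convert hs.tsum_ofReal_ne_top using 4 with n
    rw [ENNReal.ofReal_mul (by positivity), ENNReal.ofReal_add (by positivity) (by positivity),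
      ENNReal.ofReal_natCast, ENNReal.ofReal_ofNat]
    rfl
  simpa [hd, ENNReal.tsum_sigma', lt_top_iff_ne_top, hν.ne] using h

theorem base_injective : Function.Injective M.base := fun _ _ h =>
  M.pos_injective (congrArg Prod.fst h :)

theorem upper_snd_pos (i : Σ n : ℕ, Fin (n + 2)) : 0 < (M.upper i).2 := by
  simp only [upper]; positivity

theorem lower_snd_neg (i : ℕ × L) : (M.lower i).2 < 0 := by
  simp only [lower, neg_lt_zero]; positivity

theorem base_snd (x : L) : (M.base x).2 = 0 := rfl

theorem upper_injective : Function.Injective M.upper := by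
  rintro ⟨n, k⟩ ⟨m, l⟩ h
  have h2 : (1 : ℝ) / (n + 1) = 1 / (m + 1) := congrArg Prod.snd h
  have h1 : ((k : ℕ) : ℝ) / (n + 1) = (l : ℕ) / (m + 1) := congrArg Prod.fst h
  have hnm : n = m := by
    have := inv_injective (by simpa only [one_div] using h2)
    exact_mod_cast add_right_cancel this
  subst hnm
  have hkl : ((k : ℕ) : ℝ) = (l : ℕ) := by
    have : (n + 1 : ℝ) ≠ 0 := by positivity
    field_simp at h1
    exact h1
  obtain rfl : k = l := Fin.ext (by exact_mod_cast hkl)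
  rfl

theorem lower_injective : Function.Injective M.lower := by
  rintro ⟨n, x⟩ ⟨m, y⟩ h
  have h2 : -((1 : ℝ) / (n + 1)) = -(1 / (m + 1)) := congrArg Prod.snd h
  have h1 : x = y := M.pos_injective (congrArg Prod.fst h :)
  have hnm : n = m := by
    have := inv_injective (by simpa only [one_div] using neg_injective h2)
    exact_mod_cast add_right_cancel this
  rw [h1, hnm]

theorem base_ne_upper (x : L) (i : Σ n : ℕ, Fin (n + 2)) : M.base x ≠ M.upper i := fun h =>
  (M.upper_snd_pos i).ne' (h ▸ M.base_snd x)

theorem base_ne_lower (x : L) (i : ℕ × L) : M.base x ≠ M.lower i := fun h =>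
  (M.lower_snd_neg i).ne (h ▸ M.base_snd x)

theorem lower_ne_upper (j : ℕ × L) (i : Σ n : ℕ, Fin (n + 2)) : M.lower j ≠ M.upper i := fun h =>
  ((M.lower_snd_neg j).trans (h ▸ M.upper_snd_pos i)).false

theorem measure_image_base {s : Set L} (hs : MeasurableSet s) :
    M.measure (M.base '' s) = M.ν s := by
  have hpre : M.base ⁻¹' (M.base '' s) = s := M.base_injective.preimage_image s
  have hu : ∀ i, M.upper i ∉ M.base '' s := by
    rintro i ⟨x, -, hx⟩
    exact M.base_ne_upper _ _ hx
  have hl : ∀ i, M.lower i ∉ M.base '' s := by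
    rintro i ⟨x, -, hx⟩
    exact M.base_ne_lower _ _ hx
  rw [M.measure_apply (M.measurableSet_iff.2 (by rwa [hpre])), hpre]
  simp [Set.indicator_of_notMem (hu _), Set.indicator_of_notMem (hl _)]

theorem measurableSet_image_base {s : Set L} (hs : MeasurableSet s) :
    MeasurableSet (M.base '' s) := by
  rwa [measurableSet_iff, M.base_injective.preimage_image]

theorem measure_singleton_upper (i : Σ n : ℕ, Fin (n + 2)) :
    M.measure {M.upper i} = M.e i.1 := by
  have hpre : M.base ⁻¹' {M.upper i} = ∅ := by
    ext x; simp [M.base_ne_upper]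
  rw [M.measure_apply (measurableSet_singleton _), hpre, measure_empty, zero_add,
    tsum_eq_single i]
  · simp [M.lower_ne_upper]
  · intro j hj; simp [M.upper_injective.eq_iff, hj]

theorem measure_singleton_lower (i : ℕ × L) :
    M.measure {M.lower i} = M.d i.1 := by
  have hpre : M.base ⁻¹' {M.lower i} = ∅ := by
    ext x; simp [M.base_ne_lower]
  rw [M.measure_apply (measurableSet_singleton _), hpre, measure_empty, zero_add,
    tsum_eq_single (L := .unconditional (ℕ × L)) i]
  · simp [(M.lower_ne_upper i _).symm]
  · intro j hj; simp [M.lower_injective.eq_iff, hj]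

/-! ### The differentiation basis -/

/-- The upper atom of level `n` assigned to `x`: it lies within `1 / (n + 1)` of `x` in the sup
metric if `0 < pos x < 1`. -/
noncomputable def near (n : ℕ) (x : L) : M.Plane :=
  M.upper ⟨n, Fin.ofNat (n + 2) ⌊(n + 1) * M.pos x⌋₊⟩

/-- The part of total mass `δ n` of a basic set. -/
def core (n : ℕ) (x : L) : Set M.Plane := M.base '' M.J n x ∪ {M.lower (n, x)}

/-- The basic set of level `n` around `base x`. -/
def cell (n : ℕ) (x : L) : Set M.Plane := M.core n x ∪ {M.near n x}

/-- The core of level `n` at `x` has the prescribed mass. -/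
def Good (n : ℕ) (x : L) : Prop := M.ν (M.J n x) + M.d n = ENNReal.ofReal (M.δ n)

theorem near_notMem_core (n : ℕ) (x : L) : M.near n x ∉ M.core n x := by
  rintro (⟨y, -, hy⟩ | h)
  · exact M.base_ne_upper _ _ hy
  · exact M.lower_ne_upper _ _ h.symm

theorem measurableSet_core (n : ℕ) (x : L) : MeasurableSet (M.core n x) :=
  (M.measurableSet_image_base (M.measurableSet_J n x)).union (measurableSet_singleton _)

theorem measurableSet_cell (n : ℕ) (x : L) : MeasurableSet (M.cell n x) :=
  (M.measurableSet_core n x).union (measurableSet_singleton _)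

theorem measure_core {n : ℕ} {x : L} (h : M.Good n x) :
    M.measure (M.core n x) = ENNReal.ofReal (M.δ n) := by
  rw [core, measure_union _ (measurableSet_singleton _),
    M.measure_image_base (M.measurableSet_J n x), M.measure_singleton_lower]
  · exact h
  · rw [Set.disjoint_singleton_right]
    rintro ⟨y, -, hy⟩
    exact M.base_ne_lower _ _ hy

theorem measure_near (n : ℕ) (x : L) :
    M.measure {M.near n x} = ENNReal.ofReal (M.δ n * M.t n) :=
  M.measure_singleton_upper _

theorem measure_cell {n : ℕ} {x : L} (h : M.Good n x) :
    M.measure (M.cell n x) = ENNReal.ofReal (M.δ n * (1 + M.t n)) := by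
  rw [cell, measure_union (Set.disjoint_singleton_right.2 (M.near_notMem_core n x))
    (measurableSet_singleton _), M.measure_core h, M.measure_near,
    ← ENNReal.ofReal_add (M.δ_pos n).le (mul_nonneg (M.δ_pos n).le (M.t_nonneg n))]
  ring_nf

theorem base_mem_cell (n : ℕ) (x : L) : M.base x ∈ M.cell n x :=
  Or.inl (Or.inl ⟨x, M.mem_J n x, rfl⟩)

theorem abs_near_sub_le {x : L} (hx : M.pos x ∈ Set.Ioo (0 : ℝ) 1) (n : ℕ) :
    |(M.near n x).1 - M.pos x| ≤ 1 / (n + 1) := by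
  have hn : (0 : ℝ) < n + 1 := by positivity
  have h0 : 0 ≤ (n + 1) * M.pos x := mul_nonneg hn.le hx.1.le
  have hlt : ⌊(n + 1) * M.pos x⌋₊ < n + 2 := by
    rw [Nat.floor_lt h0]
    push_cast
    nlinarith [hx.2]
  have h1 := Nat.floor_le h0
  have h2 := Nat.lt_floor_add_one ((n + 1) * M.pos x)
  have : (M.near n x).1 = (⌊(n + 1) * M.pos x⌋₊ : ℝ) / (n + 1) := by
    simp only [near, upper, Fin.ofNat, Nat.mod_eq_of_lt hlt]
  rw [this, abs_le]
  constructor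
  · rw [← sub_nonneg]
    have : (⌊(n + 1) * M.pos x⌋₊ : ℝ) / (n + 1) - M.pos x - -(1 / (n + 1)) =
      ((⌊(n + 1) * M.pos x⌋₊ : ℝ) + 1 - (n + 1) * M.pos x) / (n + 1) := by field_simp; ring
    rw [this]
    exact div_nonneg (by linarith) hn.le
  · have : (⌊(n + 1) * M.pos x⌋₊ : ℝ) / (n + 1) ≤ M.pos x := by
      rw [div_le_iff₀ hn]; linarith
    have : (0 : ℝ) ≤ 1 / (n + 1) := by positivity
    linarith

theorem cell_subset_ball {x : L} (hx : M.pos x ∈ Set.Ioo (0 : ℝ) 1) (n : ℕ) :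
    M.cell n x ⊆ Metric.ball (M.base x) (M.δ n + 2 / (n + 1)) := by
  have hn : (0 : ℝ) < 1 / (n + 1) := by positivity
  have h2 : (2 : ℝ) / (n + 1) = 1 / (n + 1) + 1 / (n + 1) := by ring
  have hδ := M.δ_pos n
  intro z hz
  have hdist : dist z (M.base x) = max |z.1 - M.pos x| |z.2 - 0| := rfl
  rw [Metric.mem_ball, hdist, max_lt_iff, sub_zero, h2]
  rcases hz with (⟨y, hy, rfl⟩ | rfl) | rfl
  · have := M.abs_sub_le n x y hy
    simp only [base, abs_zero]
    constructor <;> linarith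
  · simp only [lower, sub_self, abs_zero, abs_neg, abs_of_pos hn]
    constructor <;> linarith
  · refine ⟨(M.abs_near_sub_le hx n).trans_lt (by linarith), ?_⟩
    simp only [near, upper, abs_of_pos hn]
    linarith

/-- At points of the axis, the basic sets are the cells whose core has the right mass; at the
atoms, the atom alone. -/
def basicSets (z : M.Plane) : Set (Set M.Plane) :=
  {S | (∃ n x, z = M.base x ∧ M.Good n x ∧ S = M.cell n x) ∨
    (z.2 ≠ 0 ∧ S = {z} ∧ 0 < M.measure {z} ∧ M.measure {z} < ∞)}

theorem exists_contracting_cells {x : L} (hx : M.pos x ∈ Set.Ioo (0 : ℝ) 1)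
    (hm : ∀ᶠ n in atTop, M.Good n x) : ∃ N : ℕ, (∀ n, M.Good (n + N) x) ∧
      (∀ n, M.cell (n + N) x ∈ M.basicSets (M.base x)) ∧
      ∃ r : ℕ → ℝ, Tendsto r atTop (𝓝 0) ∧
        ∀ n, M.cell (n + N) x ⊆ Metric.ball (M.base x) (r n) := by
  obtain ⟨N, hN⟩ := eventually_atTop.1 hm
  have hN' : ∀ n, M.Good (n + N) x := fun n => hN _ (Nat.le_add_left _ _)
  refine ⟨N, hN', fun n => Or.inl ⟨n + N, x, rfl, hN' n, rfl⟩,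
    fun n => M.δ (n + N) + 2 / ((n + N : ℕ) + 1), ?_, fun n => M.cell_subset_ball hx _⟩
  have h2 : Tendsto (fun n : ℕ => (2 : ℝ) / (n + 1)) atTop (𝓝 0) := by
    simpa [div_eq_mul_inv] using
      tendsto_one_div_add_atTop_nhds_zero_nat (𝕜 := ℝ) |>.const_mul 2
  have h3 := M.δ_tendsto.add h2
  rw [add_zero] at h3
  exact h3.comp (tendsto_add_atTop_nat N)

/-- The differentiation basis formed by the basic sets. -/
noncomputable def basis : DifferentiationBasis M.measure where
  sets := M.basicSets
  measurableSet_of_mem := by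
    rintro z S (⟨n, x, -, -, rfl⟩ | ⟨-, rfl, -⟩)
    · exact M.measurableSet_cell n x
    · exact measurableSet_singleton _
  mem_of_mem := by
    rintro z S (⟨n, x, rfl, -, rfl⟩ | ⟨-, rfl, -⟩)
    · exact M.base_mem_cell n x
    · rfl
  measure_pos_of_mem := by
    rintro z S (⟨n, x, -, hg, rfl⟩ | ⟨-, rfl, h, -⟩)
    · rw [M.measure_cell hg, ENNReal.ofReal_pos]
      exact mul_pos (M.δ_pos n) (by linarith [M.t_nonneg n])
    · exact h
  measure_lt_top_of_mem := by
    rintro z S (⟨n, x, -, hg, rfl⟩ | ⟨-, rfl, -, h⟩)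
    · rw [M.measure_cell hg]
      exact ENNReal.ofReal_lt_top
    · exact h
  exists_contracting := by
    have hatom : ∀ z : M.Plane, z.2 ≠ 0 → M.measure {z} ≠ 0 → M.measure {z} ≠ ∞ →
        ∃ S : ℕ → Set M.Plane, (∀ n, S n ∈ M.basicSets z) ∧
        ∃ r : ℕ → ℝ, Tendsto r atTop (𝓝 0) ∧ ∀ n, S n ⊆ Metric.ball z (r n) := by
      intro z hz h0 ht
      refine ⟨fun _ => {z}, fun _ => Or.inr ⟨hz, rfl, h0.bot_lt, ht.lt_top⟩,
        fun n => 1 / ((n : ℝ) + 1), tendsto_one_div_add_atTop_nhds_zero_nat, fun n => ?_⟩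
      rw [Set.singleton_subset_iff]
      exact Metric.mem_ball_self (by positivity)
    refine M.measure_eq_zero ?_ ?_ ?_
    · suffices h : ∀ᵐ x ∂M.ν, ∃ S : ℕ → Set M.Plane, (∀ n, S n ∈ M.basicSets (M.base x)) ∧
          ∃ r : ℕ → ℝ, Tendsto r atTop (𝓝 0) ∧ ∀ n, S n ⊆ Metric.ball (M.base x) (r n) from h
      filter_upwards [M.pos_mem, M.mass] with x hx hm
      obtain ⟨N, -, hN⟩ := M.exists_contracting_cells hx hm
      exact ⟨_, hN⟩
    · intro i hi
      by_contra h0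
      refine hi (hatom _ (M.upper_snd_pos i).ne' ?_ ?_) <;> rw [M.measure_singleton_upper]
      · exact h0
      · exact ENNReal.ofReal_ne_top
    · intro i hi
      by_contra h0
      refine hi (hatom _ (M.lower_snd_neg i).ne ?_ ?_) <;> rw [M.measure_singleton_lower]
      · exact_mod_cast h0
      · exact ENNReal.coe_ne_top

end AtomicExtension

/-! ### Criteria for differentiation -/

namespace AtomicExtension

variable {L : Type} [MeasurableSpace L] (M : AtomicExtension L)

/-- The upper atom in a cell at height `1 / (n + 1)` keeps the cell from being contained in small
balls, so the levels of a contracting sequence of cells tend to infinity. -/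
theorem exists_levels_of_contracts {S : ℕ → Set M.Plane} {x : L}
    (hS : M.basis.Contracts S (M.base x)) :
    ∃ φ : ℕ → ℕ, Tendsto φ atTop atTop ∧ ∀ i, M.Good (φ i) x ∧ S i = M.cell (φ i) x := by
  have h : ∀ i, ∃ n, M.Good n x ∧ S i = M.cell n x := by
    intro i
    rcases hS.1 i with ⟨n, y, hy, hg, hSi⟩ | ⟨h0, -⟩
    · obtain rfl := M.base_injective hy
      exact ⟨n, hg, hSi⟩
    · exact absurd (M.base_snd x) h0
  choose φ hφ using h
  refine ⟨φ, ?_, hφ⟩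
  obtain ⟨r, hr, hSr⟩ := hS.2
  refine tendsto_atTop.2 fun N => ?_
  filter_upwards [hr.eventually (gt_mem_nhds (show (0 : ℝ) < 1 / (N + 1) by positivity))] with i hi
  by_contra hN
  have hmem : M.near (φ i) x ∈ Metric.ball (M.base x) (r i) := by
    refine hSr i ?_
    rw [(hφ i).2]
    exact Or.inr rfl
  have hdist : dist (M.near (φ i) x) (M.base x) =
    max |(M.near (φ i) x).1 - M.pos x| |1 / ((φ i : ℝ) + 1) - 0| := rfl
  rw [Metric.mem_ball, hdist, max_lt_iff, sub_zero] at hmem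
  have h1 := (le_abs_self _).trans_lt (hmem.2.trans hi)
  have h2 : (φ i : ℝ) + 1 ≤ N + 1 := by
    have : (φ i : ℝ) ≤ N := by exact_mod_cast (not_le.1 hN).le
    linarith
  exact absurd h1 (not_lt.2 (one_div_le_one_div_of_le (by positivity) h2))

theorem setAverage_cell {f : M.Plane → ℝ} {n : ℕ} {x : L} (hg : M.Good n x)
    (hf : IntegrableOn f (M.cell n x) M.measure) :
    ⨍ y in M.cell n x, f y ∂M.measure =
      ((⨍ y in M.core n x, f y ∂M.measure) + f (M.near n x) * M.t n) / (1 + M.t n) := by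
  have hδ := M.δ_pos n
  have ht : 0 < 1 + M.t n := by linarith [M.t_nonneg n]
  have h1 : M.measure.real (M.cell n x) = M.δ n * (1 + M.t n) := by
    rw [measureReal_def, M.measure_cell hg, ENNReal.toReal_ofReal (mul_pos hδ ht).le]
  have h2 : M.measure.real (M.core n x) = M.δ n := by
    rw [measureReal_def, M.measure_core hg, ENNReal.toReal_ofReal hδ.le]
  have h3 : M.measure.real {M.near n x} = M.δ n * M.t n := by
    rw [measureReal_def, M.measure_near, ENNReal.toReal_ofReal (mul_nonneg hδ.le (M.t_nonneg n))]
  rw [setAverage_eq, setAverage_eq, h1, h2, cell,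
    setIntegral_union (Set.disjoint_singleton_right.2 (M.near_notMem_core n x))
      (measurableSet_singleton _) (hf.mono_set Set.subset_union_left)
      (hf.mono_set Set.subset_union_right), integral_singleton, h3]
  simp only [smul_eq_mul]
  field_simp

theorem differentiatesAt_of_snd_ne_zero (f : M.Plane → ℝ) {z : M.Plane} (hz : z.2 ≠ 0) :
    M.basis.DifferentiatesAt f z := by
  intro S hS
  have h : ∀ n, ⨍ y in S n, f y ∂M.measure = f z := by
    intro n
    rcases hS.1 n with ⟨n, y, rfl, -⟩ | ⟨-, hSn, h0, ht⟩
    · exact absurd (M.base_snd y) hz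
    · rw [hSn, setAverage_eq, integral_singleton, smul_smul, inv_mul_cancel₀, one_smul]
      exact (ENNReal.toReal_pos h0.ne' ht.ne).ne'
  simp only [h]
  exact tendsto_const_nhds

/-- If the upper atoms have a vanishing share of the mass, it is enough to control the averages
over the cores and the contribution of the upper atoms separately. -/
theorem differentiates_of_tendsto {p : ℝ≥0∞} (hp : 1 ≤ p) (ht : Tendsto M.t atTop (𝓝 0))
    (hcore : ∀ f : M.Plane → ℝ, Measurable f → eLpNorm f p M.measure < ∞ → ∀ᵐ x ∂M.ν,
      Tendsto (fun n => ⨍ y in M.core n x, f y ∂M.measure) atTop (𝓝 (f (M.base x))))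
    (hnear : ∀ f : M.Plane → ℝ, Measurable f → eLpNorm f p M.measure < ∞ → ∀ x,
      Tendsto (fun n => f (M.near n x) * M.t n) atTop (𝓝 0)) :
    M.basis.Differentiates p := by
  intro f hf hfp
  suffices h : M.measure {z | ¬ M.basis.DifferentiatesAt f z} = 0 from
    ⟨M.isComplete_measure.out' _ h, h⟩
  refine M.measure_eq_zero ?_ ?_ ?_
  · suffices h : ∀ᵐ x ∂M.ν, M.basis.DifferentiatesAt f (M.base x) from h
    filter_upwards [hcore f hf hfp] with x hx S hS
    obtain ⟨φ, hφ, hSφ⟩ := M.exists_levels_of_contracts hS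
    have hlim : Tendsto (fun n => ((⨍ y in M.core n x, f y ∂M.measure) +
        f (M.near n x) * M.t n) / (1 + M.t n)) atTop (𝓝 (f (M.base x))) := by
      have := (hx.add (hnear f hf hfp x)).div (ht.const_add 1) (by norm_num)
      rwa [add_zero, add_zero, div_one] at this
    refine (hlim.comp hφ).congr fun i => ?_
    rw [(hSφ i).2]
    refine (M.setAverage_cell (hSφ i).1 ?_).symm
    refine integrableOn_of_eLpNorm_lt_top hf hp hfp ?_
    rw [M.measure_cell (hSφ i).1]
    exact ENNReal.ofReal_lt_top
  · exact fun i hi => absurd (M.differentiatesAt_of_snd_ne_zero f (M.upper_snd_pos i).ne') hi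
  · exact fun i hi => absurd (M.differentiatesAt_of_snd_ne_zero f (M.lower_snd_neg i).ne) hi

theorem not_differentiates_of_le {p : ℝ≥0∞} (hp : 1 ≤ p) {f : M.Plane → ℝ} (hf : Measurable f)
    (hfp : eLpNorm f p M.measure < ∞) (h0 : ∀ z, 0 ≤ f z) (hbase : ∀ x, f (M.base x) = 0)
    (hle : ∀ n x, M.Good n x → ∃ z ∈ M.cell n x,
      M.measure.real (M.cell n x) / 2 ≤ M.measure.real {z} * f z) :
    ¬ M.basis.Differentiates p := by
  intro hdiff
  have hae : ∀ᵐ x ∂M.ν, M.basis.DifferentiatesAt f (M.base x) :=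
    nonpos_iff_eq_zero.1 ((hdiff f hf hfp).2 ▸ M.measure_preimage_base_le _)
  have : (ae M.ν).NeBot := ae_neBot.2 M.ne_zero
  obtain ⟨x, hx, hpos, hmass⟩ := (hae.and (M.pos_mem.and M.mass)).exists
  obtain ⟨N, hN, hc⟩ := M.exists_contracting_cells hpos hmass
  have hlim := hx _ hc
  rw [hbase] at hlim
  have hge : ∀ n, 1 / 2 ≤ ⨍ y in M.cell (n + N) x, f y ∂M.measure := by
    intro n
    obtain ⟨z, hz, hle⟩ := hle _ x (hN n)
    have hcell := M.measure_cell (hN n)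
    have hpos : 0 < M.measure.real (M.cell (n + N) x) := by
      rw [measureReal_def, hcell, ENNReal.toReal_ofReal_eq_iff.2] <;>
      nlinarith [M.δ_pos (n + N), M.t_nonneg (n + N)]
    have hint : IntegrableOn f (M.cell (n + N) x) M.measure :=
      integrableOn_of_eLpNorm_lt_top hf hp hfp (hcell ▸ ENNReal.ofReal_lt_top)
    have hmono := setIntegral_mono_set hint (ae_of_all _ h0)
      (Set.singleton_subset_iff.2 hz).eventuallyLE
    rw [integral_singleton, smul_eq_mul] at hmono
    rw [setAverage_eq, smul_eq_mul, inv_mul_eq_div, le_div_iff₀ hpos]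
    linarith
  exact absurd (ge_of_tendsto' hlim hge) (by norm_num)

/-- The upper atoms near a fixed point are distinct, so the terms `|f (near n x)| ^ p * e n` are
summable for `f` of class `L^p`. -/
theorem tendsto_near_of_ne_top {p : ℝ≥0∞} (hp : 1 ≤ p) (hpt : p ≠ ∞)
    (hle : ∀ᶠ n in atTop, M.t n ^ p.toReal ≤ M.δ n * M.t n) {f : M.Plane → ℝ} (hf : Measurable f)
    (hfp : eLpNorm f p M.measure < ∞) (x : L) :
    Tendsto (fun n => f (M.near n x) * M.t n) atTop (𝓝 0) := by
  have hp0 : p ≠ 0 := (zero_lt_one.trans_le hp).ne'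
  have hq : 0 < p.toReal := ENNReal.toReal_pos hp0 hpt
  have hfin := lintegral_rpow_enorm_lt_top_of_eLpNorm_lt_top hp0 hpt hfp
  rw [M.lintegral_measure (hf.enorm.pow_const _)] at hfin
  have hinj : Function.Injective fun n : ℕ =>
      (⟨n, Fin.ofNat (n + 2) ⌊(n + 1) * M.pos x⌋₊⟩ : Σ n : ℕ, Fin (n + 2)) :=
    fun n m h => congrArg Sigma.fst h
  have hsum : ∑' n, M.e n * ‖f (M.near n x)‖ₑ ^ p.toReal ≠ ∞ := by
    refine ne_top_of_le_ne_top hfin.ne (le_trans ?_ (le_trans le_add_self le_self_add))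
    exact ENNReal.tsum_comp_le_tsum_of_injective hinj
      fun i => M.e i.1 * ‖f (M.upper i)‖ₑ ^ p.toReal
  have h1 := ENNReal.tendsto_atTop_zero_of_tsum_ne_top hsum
  have h2 : Tendsto (fun n => ‖f (M.near n x) * M.t n‖ₑ ^ p.toReal) atTop (𝓝 0) := by
    refine tendsto_of_tendsto_of_tendsto_of_le_of_le' tendsto_const_nhds h1
      (Eventually.of_forall fun _ => zero_le) ?_
    filter_upwards [hle] with n hn
    rw [enorm_mul, ENNReal.mul_rpow_of_nonneg _ _ hq.le, mul_comm]
    gcongr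
    rw [Real.enorm_of_nonneg (M.t_nonneg n), ENNReal.ofReal_rpow_of_nonneg (M.t_nonneg n) hq.le]
    exact ENNReal.ofReal_le_ofReal hn
  have h3 := ((ENNReal.continuous_rpow_const (y := p.toReal⁻¹)).tendsto 0).comp h2
  rw [ENNReal.zero_rpow_of_pos (inv_pos.2 hq)] at h3
  rw [tendsto_zero_iff_norm_tendsto_zero]
  have h4 := (ENNReal.tendsto_toReal ENNReal.zero_ne_top).comp h3
  refine h4.congr fun n => ?_
  simp only [Function.comp_apply]
  rw [← ENNReal.rpow_mul, mul_inv_cancel₀ hq.ne', ENNReal.rpow_one, toReal_enorm]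

theorem tendsto_near_of_eq_top (ht : Tendsto M.t atTop (𝓝 0)) {f : M.Plane → ℝ}
    (hfp : eLpNorm f ∞ M.measure < ∞) (x : L) :
    Tendsto (fun n => f (M.near n x) * M.t n) atTop (𝓝 0) := by
  rw [eLpNorm_exponent_top] at hfp
  have hbound : ∀ n, |f (M.near n x) * M.t n| ≤
      (eLpNormEssSup f M.measure).toReal * M.t n := by
    intro n
    rw [abs_mul, abs_of_nonneg (M.t_nonneg n)]
    rcases (M.t_nonneg n).eq_or_lt with h | h
    · simp [← h]
    · gcongr
      by_contra hcon
      have h1 := ae_le_eLpNormEssSup (f := f) (μ := M.measure)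
      have h2 : M.measure {M.near n x} = 0 := by
        refine measure_mono_null (Set.singleton_subset_iff.2 ?_) h1
        intro hle
        refine hcon ?_
        rw [← Real.norm_eq_abs, ← toReal_enorm]
        exact ENNReal.toReal_mono hfp.ne hle
      rw [M.measure_near, ENNReal.ofReal_eq_zero] at h2
      exact absurd h2 (not_le.2 (mul_pos (M.δ_pos n) h))
  refine squeeze_zero_norm hbound ?_
  simpa using ht.const_mul (eLpNormEssSup f M.measure).toReal

/-- The function equal to `1 / t n` on the upper atoms of level `n`, and to `0` elsewhere. Its
average over a basic set of level `n` is at least `1 / 2` if `0 < t n`. -/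
noncomputable def spike : M.Plane → ℝ := Function.extend M.upper (fun i => (M.t i.1)⁻¹) 0

theorem spike_upper (i : Σ n : ℕ, Fin (n + 2)) : M.spike (M.upper i) = (M.t i.1)⁻¹ :=
  M.upper_injective.extend_apply _ _ _

theorem spike_eq_zero {z : M.Plane} (hz : z.2 ≤ 0) : M.spike z = 0 :=
  Function.extend_apply' _ _ _ (by
    rintro ⟨i, rfl⟩
    exact absurd (M.upper_snd_pos i) (not_lt.2 hz))

theorem spike_base (x : L) : M.spike (M.base x) = 0 := M.spike_eq_zero (M.base_snd x).le

theorem spike_nonneg (z : M.Plane) : 0 ≤ M.spike z := by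
  by_cases h : ∃ i, M.upper i = z
  · obtain ⟨i, rfl⟩ := h
    rw [spike_upper]
    exact inv_nonneg.2 (M.t_nonneg i.1)
  · have : M.spike z = 0 := Function.extend_apply' _ _ _ h
    rw [this]

theorem measurable_spike : Measurable M.spike := by
  rw [measurable_iff, show M.spike ∘ M.base = fun _ => 0 from funext M.spike_base]
  exact measurable_const

theorem not_differentiates_of_eLpNorm_spike {p : ℝ≥0∞} (hp : 1 ≤ p) (ht : ∀ n, 0 < M.t n)
    (h : eLpNorm M.spike p M.measure < ∞) : ¬ M.basis.Differentiates p := by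
  refine M.not_differentiates_of_le hp M.measurable_spike h M.spike_nonneg M.spike_base
    fun n x hg => ⟨M.near n x, Or.inr rfl, ?_⟩
  have hδ := M.δ_pos n
  have h2 := M.t_le_one n
  have h1 := M.t_nonneg n
  rw [measureReal_def, measureReal_def, M.measure_cell hg, M.measure_near, near, spike_upper,
    ENNReal.toReal_ofReal (by positivity), ENNReal.toReal_ofReal (by positivity),
    mul_inv_cancel_right₀ (ht n).ne']
  nlinarith

theorem not_differentiates_of_summable {p : ℝ≥0∞} (hp : 1 ≤ p) (hpt : p ≠ ∞) (ht : ∀ n, 0 < M.t n)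
    (h : Summable fun n : ℕ => (n + 2) * (M.δ n * M.t n * (M.t n)⁻¹ ^ p.toReal)) :
    ¬ M.basis.Differentiates p := by
  refine M.not_differentiates_of_eLpNorm_spike hp ht ?_
  have hp0 : p ≠ 0 := (zero_lt_one.trans_le hp).ne'
  have hq : 0 < p.toReal := ENNReal.toReal_pos hp0 hpt
  rw [eLpNorm_lt_top_iff_lintegral_rpow_enorm_lt_top hp0 hpt,
    M.lintegral_measure (M.measurable_spike.enorm.pow_const _)]
  have h0 : ∀ i, M.spike (M.lower i) = 0 := fun i => M.spike_eq_zero (M.lower_snd_neg i).le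
  have hs : ∑' n : ℕ, (n + 2 : ℝ≥0∞) * (M.e n * ‖(M.t n)⁻¹‖ₑ ^ p.toReal) ≠ ∞ := by
    convert h.tsum_ofReal_ne_top using 4 with n
    have h1 : 0 ≤ M.t n := M.t_nonneg n
    have h2 := (M.δ_pos n).le
    rw [ENNReal.ofReal_mul (by positivity), ENNReal.ofReal_add (by positivity) (by positivity),
      ENNReal.ofReal_natCast, ENNReal.ofReal_ofNat, ENNReal.ofReal_mul (by positivity),
      Real.enorm_of_nonneg (inv_nonneg.2 h1), ENNReal.ofReal_rpow_of_nonneg (inv_nonneg.2 h1) hq.le]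
    rfl
  simpa [spike_base, spike_upper, h0, hq, ENNReal.tsum_sigma', lt_top_iff_ne_top] using hs

theorem not_differentiates_of_t_eq_one {p : ℝ≥0∞} (hp : 1 ≤ p) (ht : ∀ n, M.t n = 1)
    (hμ : M.measure Set.univ < ∞) : ¬ M.basis.Differentiates p := by
  refine M.not_differentiates_of_eLpNorm_spike hp (fun n => by simp [ht]) ?_
  have : IsFiniteMeasure M.measure := ⟨hμ⟩
  refine (MemLp.of_bound M.measurable_spike.aestronglyMeasurable 1 (ae_of_all _ fun z => ?_)).2
  by_cases h : ∃ i, M.upper i = z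
  · obtain ⟨i, rfl⟩ := h
    simp [spike_upper, ht]
  · have : M.spike z = 0 := Function.extend_apply' _ _ _ h
    simp [this]

end AtomicExtension

/-! ### The two families of examples -/

/-- The two numerical sequences on which the examples depend: `δ n` is the mass of a core of level
`n`, and `t n` the share of the upper atom. -/
structure Profile where
  δ : ℕ → ℝ
  t : ℕ → ℝ
  δ_pos : ∀ n, 0 < δ n
  δ_tendsto : Tendsto δ atTop (𝓝 0)
  t_nonneg : ∀ n, 0 ≤ t n
  t_le_one : ∀ n, t n ≤ 1

namespace AtomicExtension

variable {L : Type} [MeasurableSpace L] (M : AtomicExtension L)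

theorem restrict_image_base {s : Set L} (hs : MeasurableSet s) :
    M.measure.restrict (M.base '' s) = Measure.map M.base (M.ν.restrict s) := by
  ext A hA
  rw [Measure.restrict_apply hA, Measure.map_apply M.measurable_base hA,
    Measure.restrict_apply (M.measurable_base hA),
    ← M.measure_image_base ((M.measurable_base hA).inter hs), Set.image_preimage_inter]

theorem setAverage_core {f : M.Plane → ℝ} (hf : Measurable f) {n : ℕ} (hd : M.d n = 0) (x : L) :
    ⨍ y in M.core n x, f y ∂M.measure = ⨍ y in M.J n x, f (M.base y) ∂M.ν := by
  have h0 : M.measure {M.lower (n, x)} = 0 := by rw [M.measure_singleton_lower]; simp [hd]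
  have hae : M.core n x =ᵐ[M.measure] M.base '' M.J n x := union_ae_eq_left_of_ae_eq_empty
    (ae_eq_empty.2 h0)
  rw [setAverage_congr hae, setAverage_eq, setAverage_eq,
    M.restrict_image_base (M.measurableSet_J n x),
    integral_map M.measurable_base.aemeasurable hf.aestronglyMeasurable, measureReal_def,
    M.measure_image_base (M.measurableSet_J n x), measureReal_def]

end AtomicExtension

section Completion

variable {α : Type*} [MeasurableSpace α] {μ : Measure α}

theorem measurable_id_nullMeasurableSpace :
    @Measurable (NullMeasurableSpace α μ) α _ _ (fun x => x) :=
  fun _ hs => MeasurableSet.nullMeasurableSet hs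

theorem map_id_completion :
    @Measure.map (NullMeasurableSpace α μ) α _ _ (fun x => x) μ.completion = μ := by
  ext s hs
  rw [Measure.map_apply measurable_id_nullMeasurableSpace hs]
  rfl

theorem integral_completion {F : α → ℝ} (hF : AEStronglyMeasurable F μ) :
    @integral (NullMeasurableSpace α μ) ℝ _ _ _ μ.completion F = ∫ x, F x ∂μ := by
  obtain ⟨g, hg, hFg⟩ := hF
  rw [integral_congr_ae hFg]
  conv_rhs => rw [← map_id_completion (μ := μ)]
  rw [integral_map measurable_id_nullMeasurableSpace.aemeasurable hg.aestronglyMeasurable]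
  exact integral_congr_ae (μ := μ.completion) hFg

theorem lintegral_completion {F : α → ℝ≥0∞} (hF : AEMeasurable F μ) :
    @lintegral (NullMeasurableSpace α μ) _ μ.completion F = ∫⁻ x, F x ∂μ := by
  obtain ⟨g, hg, hFg⟩ := hF
  rw [lintegral_congr_ae hFg]
  conv_rhs => rw [← map_id_completion (μ := μ)]
  rw [lintegral_map hg measurable_id_nullMeasurableSpace]
  exact lintegral_congr_ae (μ := μ.completion) hFg

end Completion

/-- Lebesgue measure on the unit interval. -/
noncomputable def unitVolume : Measure ℝ := volume.restrict (Set.Ioo 0 1)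

theorem eventually_closedBall_subset_Ioo (P : Profile) {x : ℝ} (hx : x ∈ Set.Ioo (0 : ℝ) 1) :
    ∀ᶠ n in atTop, Metric.closedBall x (P.δ n / 2) ⊆ Set.Ioo 0 1 := by
  obtain ⟨ε, hε, hsub⟩ := Metric.isOpen_iff.1 isOpen_Ioo x hx
  filter_upwards [P.δ_tendsto.eventually (gt_mem_nhds hε)] with n hn
  refine (Metric.closedBall_subset_ball ?_).trans hsub
  linarith [P.δ_pos n]

/-- The examples of finite measure: the base line is the unit interval with the completed Lebesgue
measure, and the cores are intervals. There are no lower atoms. -/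
noncomputable def lebesgueModel (P : Profile) :
    AtomicExtension (NullMeasurableSpace ℝ unitVolume) where
  ν := unitVolume.completion
  pos := fun x => x
  d := 0
  J := fun n x => Metric.closedBall (α := ℝ) x (P.δ n / 2)
  δ := P.δ
  t := P.t
  isComplete := inferInstance
  ne_zero := by
    intro h
    have h1 : unitVolume Set.univ = 0 := by
      rw [← Measure.coe_completion, h]; rfl
    simp [unitVolume] at h1
  measurable_pos := measurable_id_nullMeasurableSpace
  pos_injective := fun _ _ h => h
  pos_mem := show ∀ᵐ x ∂unitVolume, x ∈ Set.Ioo (0 : ℝ) 1 from ae_restrict_mem measurableSet_Ioo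
  measurableSet_J := fun _ _ => MeasurableSet.nullMeasurableSet measurableSet_closedBall
  mem_J := fun n _ => Metric.mem_closedBall_self (α := ℝ) (by linarith [P.δ_pos n])
  abs_sub_le := fun n x y hy => by
    have h : |(show ℝ from y) - (show ℝ from x)| ≤ P.δ n / 2 := hy
    exact h.trans (by linarith [P.δ_pos n])
  δ_pos := P.δ_pos
  δ_tendsto := P.δ_tendsto
  t_nonneg := P.t_nonneg
  t_le_one := P.t_le_one
  mass := by
    suffices h : ∀ᵐ x ∂unitVolume, ∀ᶠ n in atTop,
        unitVolume (Metric.closedBall (x : ℝ) (P.δ n / 2)) + (0 : NNReal) =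
          ENNReal.ofReal (P.δ n) from h
    filter_upwards [ae_restrict_mem measurableSet_Ioo] with x hx
    filter_upwards [eventually_closedBall_subset_Ioo P hx] with n hn
    rw [unitVolume, Measure.restrict_apply measurableSet_closedBall, Set.inter_eq_left.2 hn,
      Real.volume_closedBall, ENNReal.coe_zero, add_zero]
    ring_nf

theorem lebesgueModel_measure_univ_lt_top (P : Profile)
    (hs : Summable fun n : ℕ => (n + 2) * (P.δ n * P.t n)) :
    (lebesgueModel P).measure Set.univ < ∞ := by
  refine (lebesgueModel P).measure_univ_lt_top ?_ (fun _ => rfl) hs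
  change unitVolume Set.univ < ∞
  simp [unitVolume]

/-- The averages over the cores are controlled by the Lebesgue differentiation theorem. -/
theorem lebesgueModel_tendsto_core (P : Profile)
    (hs : Summable fun n : ℕ => (n + 2) * (P.δ n * P.t n)) {p : ℝ≥0∞} (hp : 1 ≤ p) :
    ∀ f : (lebesgueModel P).Plane → ℝ, Measurable f → eLpNorm f p (lebesgueModel P).measure < ∞ → ∀ᵐ x ∂(lebesgueModel P).ν, Tendsto
      (fun n => ⨍ y in (lebesgueModel P).core n x, f y ∂(lebesgueModel P).measure) atTop
      (𝓝 (f ((lebesgueModel P).base x))) := by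
  set M := lebesgueModel P
  intro f hf hfp
  set F : ℝ → ℝ := fun x => f (M.base x)
  have hF : AEMeasurable F unitVolume :=
    NullMeasurable.aemeasurable (fun s hs => M.measurable_base (hf hs))
  have hfin := integrableOn_of_eLpNorm_lt_top hf hp hfp (lebesgueModel_measure_univ_lt_top P hs)
  rw [integrableOn_univ] at hfin
  have hFint : Integrable F unitVolume := by
    refine ⟨hF.aestronglyMeasurable, ?_⟩
    have h := hfin.2
    rw [HasFiniteIntegral, M.lintegral_measure hf.enorm, add_assoc] at h
    have h2 := le_self_add.trans_lt h
    rw [HasFiniteIntegral, ← lintegral_completion hF.enorm]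
    exact h2
  have hloc : LocallyIntegrable ((Set.Ioo (0 : ℝ) 1).indicator F) volume :=
    ((integrable_indicator_iff measurableSet_Ioo).2 hFint).locallyIntegrable
  have hae := ae_restrict_of_ae (s := Set.Ioo (0 : ℝ) 1)
    (IsUnifLocDoublingMeasure.ae_tendsto_average volume hloc 1)
  have hunit : ∀ᵐ x ∂unitVolume, x ∈ Set.Ioo (0 : ℝ) 1 := ae_restrict_mem measurableSet_Ioo
  suffices h : ∀ᵐ (x : ℝ) ∂unitVolume, Tendsto (fun n => ⨍ y in M.core n x, f y ∂M.measure) atTop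
      (𝓝 (F x)) from h
  filter_upwards [hae, hunit] with x hx hmem
  replace hmem : x ∈ Set.Ioo (0 : ℝ) 1 := hmem
  have hδ : Tendsto (fun n => P.δ n / 2) atTop (𝓝[>] 0) := by
    refine tendsto_nhdsWithin_iff.2 ⟨by simpa using P.δ_tendsto.div_const 2,
      Eventually.of_forall fun n => ?_⟩
    have := P.δ_pos n
    simp only [Set.mem_Ioi]; linarith
  have hlim := hx (fun _ : ℕ => x) (fun n => P.δ n / 2) hδ (Eventually.of_forall fun n =>
    Metric.mem_closedBall_self (by linarith [P.δ_pos n]))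
  rw [Set.indicator_of_mem hmem] at hlim
  refine hlim.congr' ?_
  filter_upwards [eventually_closedBall_subset_Ioo P hmem] with n hn
  refine Eq.trans ?_ (M.setAverage_core hf rfl x).symm
  set I := Metric.closedBall x (P.δ n / 2)
  have hIm : MeasurableSet I := measurableSet_closedBall
  have hres : unitVolume.restrict I = volume.restrict I := by
    rw [unitVolume, Measure.restrict_restrict hIm, Set.inter_eq_left.2 hn]
  have hmeas : unitVolume I = volume I := by
    rw [unitVolume, Measure.restrict_apply hIm, Set.inter_eq_left.2 hn]
  have hcomp : ∫ y in M.J n x, f (M.base y) ∂M.ν = ∫ y in I, F y ∂volume := by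
    rw [← integral_indicator (M.measurableSet_J n x), ← hres, ← integral_indicator hIm]
    exact integral_completion (hF.indicator hIm).aestronglyMeasurable
  rw [setAverage_eq, setAverage_eq, hcomp]
  congr 1
  · rw [measureReal_def, measureReal_def, ← hmeas]
    rfl
  · exact setIntegral_congr_fun hIm fun y hy => Set.indicator_of_mem (hn hy) F

theorem lebesgueModel_differentiates (P : Profile)
    (hs : Summable fun n : ℕ => (n + 2) * (P.δ n * P.t n)) (ht : Tendsto P.t atTop (𝓝 0))
    {p : ℝ≥0∞} (hp : 1 ≤ p) (h : p ≠ ∞ → ∀ᶠ n in atTop, P.t n ^ p.toReal ≤ P.δ n * P.t n) :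
    (lebesgueModel P).basis.Differentiates p := by
  refine (lebesgueModel P).differentiates_of_tendsto hp ht
    (lebesgueModel_tendsto_core P hs hp) fun f hf hfp x => ?_
  by_cases hpt : p = ∞
  · exact (lebesgueModel P).tendsto_near_of_eq_top ht (hpt ▸ hfp) x
  · exact (lebesgueModel P).tendsto_near_of_ne_top hp hpt (h hpt) hf hfp x

/-- The real line, every subset of which is measurable. -/
def DiscreteReal : Type := ℝ

instance : MeasurableSpace DiscreteReal := ⊤

/-- The point of the real line underlying an element of `DiscreteReal`. -/
def DiscreteReal.toReal (x : DiscreteReal) : ℝ := x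

/-- The set of elements of `DiscreteReal` in the unit interval. -/
def discreteInterval : Set DiscreteReal := DiscreteReal.toReal ⁻¹' Set.Ioo 0 1

open scoped Classical in
/-- The measure that is `0` on the sets with countably many points in the unit interval, and `∞` on
all other sets. No set has positive finite measure. -/
noncomputable def uncountabilityMeasure : Measure DiscreteReal :=
  Measure.ofMeasurable (fun A _ => if (A ∩ discreteInterval).Countable then 0 else ∞)
    (by simp) (by
      intro A hA hdisj
      by_cases h : ∀ n, (A n ∩ discreteInterval).Countable
      · have : ((⋃ n, A n) ∩ discreteInterval).Countable := by
          rw [Set.iUnion_inter]; exact Set.countable_iUnion h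
        simp [h, this]
      · push Not at h
        obtain ⟨n, hn⟩ := h
        have : ¬ ((⋃ n, A n) ∩ discreteInterval).Countable := fun hc =>
          hn (hc.mono (Set.inter_subset_inter_left _ (Set.subset_iUnion A n)))
        rw [if_neg this]
        refine (ENNReal.tsum_eq_top_of_eq_top ⟨n, if_neg hn⟩).symm)

theorem uncountabilityMeasure_eq_zero {A : Set DiscreteReal}
    (hA : (A ∩ discreteInterval).Countable) : uncountabilityMeasure A = 0 := by
  rw [uncountabilityMeasure, Measure.ofMeasurable_apply A trivial, if_pos hA]

theorem countable_of_uncountabilityMeasure_ne_top {A : Set DiscreteReal}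
    (hA : uncountabilityMeasure A ≠ ∞) : (A ∩ discreteInterval).Countable := by
  by_contra h
  rw [uncountabilityMeasure, Measure.ofMeasurable_apply A trivial, if_neg h] at hA
  exact hA rfl

theorem not_countable_discreteInterval : ¬ discreteInterval.Countable := by
  intro h
  have h' : (Set.Ioo (0 : ℝ) 1).Countable := h
  have := h'.measure_zero volume
  simp at this

/-- The examples whose base line carries no set of positive finite measure. The core of a cell is a
point of the line together with a private atom. -/
noncomputable def discreteModel (P : Profile) : AtomicExtension DiscreteReal where
  ν := uncountabilityMeasure
  pos := DiscreteReal.toReal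
  d := fun n => (P.δ n).toNNReal
  J := fun _ x => {x}
  δ := P.δ
  t := P.t
  isComplete := ⟨fun _ _ => trivial⟩
  ne_zero := by
    intro h
    refine not_countable_discreteInterval ?_
    simpa using countable_of_uncountabilityMeasure_ne_top (A := discreteInterval) (by simp [h])
  measurable_pos := fun _ _ => trivial
  pos_injective := fun _ _ h => h
  pos_mem := uncountabilityMeasure_eq_zero (by
    have : {x : DiscreteReal | x.toReal ∈ Set.Ioo (0 : ℝ) 1}ᶜ ∩ discreteInterval = ∅ :=
      Set.compl_inter_self discreteInterval
    exact this ▸ Set.countable_empty)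
  measurableSet_J := fun _ _ => trivial
  mem_J := fun _ _ => rfl
  abs_sub_le := fun n x y hy => by
    rw [Set.mem_singleton_iff.1 hy, sub_self, abs_zero]
    exact (P.δ_pos n).le
  δ_pos := P.δ_pos
  δ_tendsto := P.δ_tendsto
  t_nonneg := P.t_nonneg
  t_le_one := P.t_le_one
  mass := ae_of_all _ fun x => Eventually.of_forall fun n => by
    rw [uncountabilityMeasure_eq_zero ((Set.countable_singleton x).mono Set.inter_subset_left),
      zero_add]
    rfl

/-- A function of class `L^p` with `p < ∞` vanishes at all but countably many lower atoms and points
of the unit interval, hence on the cores of all but countably many points of the interval. -/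
theorem discreteModel_tendsto_core (P : Profile) {p : ℝ≥0∞} (hp : 1 ≤ p) (hpt : p ≠ ∞) :
    ∀ f : (discreteModel P).Plane → ℝ, Measurable f → eLpNorm f p (discreteModel P).measure < ∞ → ∀ᵐ x ∂(discreteModel P).ν, Tendsto
      (fun n => ⨍ y in (discreteModel P).core n x, f y ∂(discreteModel P).measure) atTop
      (𝓝 (f ((discreteModel P).base x))) := by
  set M := discreteModel P
  intro f hf hfp
  set A : ℕ → Set M.Plane := fun k => {z | ENNReal.ofReal (1 / (k + 1 : ℝ)) ≤ ‖f z‖ₑ}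
  have hAm : ∀ k, MeasurableSet (A k) := fun k => measurableSet_le measurable_const hf.enorm
  have hAμ : ∀ k, M.measure (A k) ≠ ∞ := by
    intro k
    have hc : ENNReal.ofReal (1 / (k + 1 : ℝ)) ≠ 0 := by
      simp only [ne_eq, ENNReal.ofReal_eq_zero, not_le]; positivity
    exact (MemLp.meas_ge_lt_top'_enorm ⟨hf.aestronglyMeasurable, hfp⟩
      (zero_lt_one.trans_le hp).ne' hpt hc (by simp)).ne
  have hmem : ∀ z, f z ≠ 0 → ∃ k, z ∈ A k := by
    intro z hz
    obtain ⟨k, hk⟩ := exists_nat_one_div_lt (norm_pos_iff.2 hz)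
    refine ⟨k, ?_⟩
    change ENNReal.ofReal (1 / (k + 1 : ℝ)) ≤ ‖f z‖ₑ
    rw [← ofReal_norm]
    exact ENNReal.ofReal_le_ofReal hk.le
  have hbase : ∀ k, (M.base ⁻¹' A k ∩ discreteInterval).Countable := fun k =>
    countable_of_uncountabilityMeasure_ne_top
      (ne_top_of_le_ne_top (hAμ k) (M.measure_preimage_base_le (A k)))
  have hlower : ∀ k, (M.lower ⁻¹' A k).Countable := by
    intro k
    have h := hAμ k
    rw [M.measure_apply (hAm k)] at h
    refine (Summable.countable_support_ennreal (ne_top_of_le_ne_top h le_add_self)).mono ?_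
    intro i hi
    have hd : (M.d i.1 : ℝ≥0∞) ≠ 0 := ENNReal.coe_ne_zero.2 (Real.toNNReal_pos.2 (P.δ_pos i.1)).ne'
    rw [Function.mem_support, Set.indicator_of_mem (show M.lower i ∈ A k from hi)]
    simpa using hd
  have hnull : M.ν ((⋃ k, M.base ⁻¹' A k) ∪ Prod.snd '' (⋃ k, M.lower ⁻¹' A k)) = 0 := by
    refine uncountabilityMeasure_eq_zero ?_
    rw [Set.union_inter_distrib_right, Set.iUnion_inter]
    exact (Set.countable_iUnion hbase).union
      (((Set.countable_iUnion hlower).image _).mono Set.inter_subset_left)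
  filter_upwards [measure_eq_zero_iff_ae_notMem.1 hnull] with x hx
  have hx1 : f (M.base x) = 0 := by
    by_contra h
    obtain ⟨k, hk⟩ := hmem _ h
    exact hx (Or.inl (Set.mem_iUnion.2 ⟨k, hk⟩))
  have hx2 : ∀ n, f (M.lower (n, x)) = 0 := by
    intro n
    by_contra h
    obtain ⟨k, hk⟩ := hmem _ h
    exact hx (Or.inr ⟨(n, x), Set.mem_iUnion.2 ⟨k, hk⟩, rfl⟩)
  have hcore : ∀ n, ⨍ y in M.core n x, f y ∂M.measure = 0 := by
    intro n
    rw [setAverage_eq, setIntegral_eq_zero_of_forall_eq_zero, smul_zero]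
    rintro z (⟨y, rfl, rfl⟩ | rfl)
    · exact hx1
    · exact hx2 n
  simp only [hcore, hx1]
  exact tendsto_const_nhds

theorem discreteModel_differentiates (P : Profile) (ht : Tendsto P.t atTop (𝓝 0))
    {p : ℝ≥0∞} (hp : 1 ≤ p) (hpt : p ≠ ∞)
    (h : ∀ᶠ n in atTop, P.t n ^ p.toReal ≤ P.δ n * P.t n) :
    (discreteModel P).basis.Differentiates p :=
  (discreteModel P).differentiates_of_tendsto hp ht
    (discreteModel_tendsto_core P hp hpt)
    fun _ hf hfp x => (discreteModel P).tendsto_near_of_ne_top hp hpt h hf hfp x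

/-- The indicator of the lower atoms is bounded, vanishes on the axis, and has averages at least
`1 / 2` over all cells. -/
theorem discreteModel_not_differentiates_top (P : Profile) :
    ¬ (discreteModel P).basis.Differentiates ∞ := by
  set M := discreteModel P
  set f : M.Plane → ℝ := Set.indicator {z | z.2 < 0} 1
  have hbase : ∀ x, f (M.base x) = 0 := by
    intro x
    have : M.base x ∉ {z : M.Plane | z.2 < 0} := fun h =>
      (show (M.base x).2 < 0 from h).ne (M.base_snd x)
    exact Set.indicator_of_notMem this _
  have hf : Measurable f := fun _ _ => trivial
  refine M.not_differentiates_of_le le_top hf ?_ ?_ hbase ?_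
  · rw [eLpNorm_exponent_top]
    refine eLpNormEssSup_lt_top_of_ae_bound (C := 1) (ae_of_all _ fun z => ?_)
    refine (norm_indicator_le_norm_self _ _).trans (by simp)
  · exact fun z => Set.indicator_nonneg (fun _ _ => zero_le_one) z
  · intro n x hg
    refine ⟨M.lower (n, x), Or.inl (Or.inr rfl), ?_⟩
    have hmem : M.lower (n, x) ∈ {z : M.Plane | z.2 < 0} := M.lower_snd_neg (n, x)
    have h1 : f (M.lower (n, x)) = 1 := Set.indicator_of_mem hmem _
    have h2 : M.measure.real {M.lower (n, x)} = M.δ n := by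
      rw [measureReal_def, M.measure_singleton_lower]
      exact Real.coe_toNNReal _ (P.δ_pos n).le
    have hδ := M.δ_pos n
    have ht := M.t_le_one n
    have ht' := M.t_nonneg n
    rw [h1, h2, measureReal_def, M.measure_cell hg, ENNReal.toReal_ofReal (by positivity)]
    nlinarith

/-! ### The choice of the numerical sequences -/

namespace Profile

/-- The profile with `δ n = 2 ^ (-b n)` and `t n = 2 ^ (-a n)`. -/
noncomputable def ofExponents (a b : ℕ → ℝ) (ha : ∀ n, 0 ≤ a n) (hb : Tendsto b atTop atTop) :
    Profile where
  δ n := 2 ^ (-b n)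
  t n := 2 ^ (-a n)
  δ_pos n := by positivity
  δ_tendsto := (tendsto_rpow_atBot_of_base_gt_one 2 one_lt_two).comp
    (tendsto_neg_atTop_atBot.comp hb)
  t_nonneg n := by positivity
  t_le_one n := Real.rpow_le_one_of_one_le_of_nonpos one_le_two (neg_nonpos.2 (ha n))

/-- The profile `P` separates the set `G` of exponents from its complement: the upper atoms do not
affect the differentiation of `L^q` for `q ∈ G`, and the function with values `1 / t n` on the
upper atoms of level `n` lies in `L^q` for all other `q`. The first condition makes the total mass
of the upper atoms finite. -/
def Separates (P : Profile) (G : Set ℝ) : Prop :=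
  (Summable fun n : ℕ => (n + 2) * (P.δ n * P.t n)) ∧ Tendsto P.t atTop (𝓝 0) ∧
    ∀ q, 1 ≤ q → (q ∈ G → ∀ᶠ n in atTop, P.t n ^ q ≤ P.δ n * P.t n) ∧
      (q ∉ G → (∀ n, 0 < P.t n) ∧
        Summable fun n : ℕ => (n + 2) * (P.δ n * P.t n * (P.t n)⁻¹ ^ q))

theorem summable_mul_two_rpow {c : ℕ → ℝ} (hc : ∀ᶠ n : ℕ in atTop, c n ≤ -(2 * n)) :
    Summable fun n : ℕ => ((n : ℝ) + 2) * (2 : ℝ) ^ c n := by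
  refine Summable.of_norm_bounded_eventually_nat
    (g := fun n : ℕ => 2 * (1 / 2 : ℝ) ^ n) (summable_geometric_two.mul_left 2) ?_
  filter_upwards [hc] with n hn
  have h1 : (2 : ℝ) ^ c n ≤ ((2 : ℝ) ^ n)⁻¹ * ((2 : ℝ) ^ n)⁻¹ := by
    rw [← mul_inv, ← pow_add, ← Real.rpow_natCast, ← Real.rpow_neg zero_le_two]
    refine Real.rpow_le_rpow_of_exponent_le one_le_two (hn.trans (le_of_eq ?_))
    push_cast
    ring
  have h2 : (n : ℝ) + 2 ≤ 2 * 2 ^ n := by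
    have h : (n : ℝ) + 1 ≤ 2 ^ n := by exact_mod_cast Nat.lt_two_pow_self (n := n)
    have : (1 : ℝ) ≤ 2 ^ n := one_le_pow₀ one_le_two
    linarith
  rw [Real.norm_of_nonneg (by positivity)]
  calc ((n : ℝ) + 2) * (2 : ℝ) ^ c n
      ≤ (2 * 2 ^ n) * (((2 : ℝ) ^ n)⁻¹ * ((2 : ℝ) ^ n)⁻¹) := by gcongr
    _ = 2 * (1 / 2 : ℝ) ^ n := by
      rw [one_div, inv_pow]
      field_simp

variable {a b : ℕ → ℝ} {ha : ∀ n, 0 ≤ a n} {hb : Tendsto b atTop atTop}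

theorem summable_ofExponents (h : ∀ᶠ n : ℕ in atTop, 2 * n ≤ a n + b n) :
    Summable fun n : ℕ =>
      ((n : ℝ) + 2) * ((ofExponents a b ha hb).δ n * (ofExponents a b ha hb).t n) := by
  refine (summable_mul_two_rpow (c := fun n => -b n + -a n) ?_).congr fun n => ?_
  · filter_upwards [h] with n hn
    linarith
  · rw [Real.rpow_add two_pos]
    rfl

/-- In terms of the exponents, `q` is good if `a + b ≤ q * a` eventually. It is bad if `q * a` is
smaller than `a + b` by `2 * n`, which makes up for the `n + 2` atoms of level `n`. -/
theorem separates_ofExponents {G : Set ℝ} (ha' : Tendsto a atTop atTop)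
    (hab : ∀ᶠ n : ℕ in atTop, 2 * n ≤ a n + b n)
    (hG : ∀ q ∈ G, 1 ≤ q → ∀ᶠ n in atTop, a n + b n ≤ q * a n)
    (hG' : ∀ q ∉ G, 1 ≤ q → ∀ᶠ n : ℕ in atTop, q * a n + 2 * n ≤ a n + b n) :
    (ofExponents a b ha hb).Separates G := by
  refine ⟨summable_ofExponents hab, (tendsto_rpow_atBot_of_base_gt_one 2 one_lt_two).comp
    (tendsto_neg_atTop_atBot.comp ha'), fun q hq => ⟨fun hqG => ?_, fun hqG => ⟨fun n => ?_, ?_⟩⟩⟩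
  · filter_upwards [hG q hqG hq] with n hn
    change ((2 : ℝ) ^ (-a n)) ^ q ≤ 2 ^ (-b n) * 2 ^ (-a n)
    rw [← Real.rpow_mul zero_le_two, ← Real.rpow_add two_pos]
    exact Real.rpow_le_rpow_of_exponent_le one_le_two (by linarith)
  · change (0 : ℝ) < 2 ^ (-a n)
    positivity
  · refine (summable_mul_two_rpow (c := fun n => -b n + -a n + a n * q) ?_).congr fun n => ?_
    · filter_upwards [hG' q hqG hq] with n hn
      linarith
    · change _ = ((n : ℝ) + 2) * (2 ^ (-b n) * 2 ^ (-a n) * ((2 : ℝ) ^ (-a n))⁻¹ ^ q)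
      rw [← Real.rpow_neg zero_le_two, neg_neg, ← Real.rpow_mul zero_le_two,
        ← Real.rpow_add two_pos, ← Real.rpow_add two_pos]

theorem eventually_mul_le_mul_sq (K : ℝ) {c : ℝ} (hc : 0 < c) :
    ∀ᶠ n : ℕ in atTop, K * n ≤ c * (n : ℝ) ^ 2 := by
  filter_upwards [eventually_ge_atTop ⌈K / c⌉₊] with n hn
  have h1 : K ≤ n * c := (div_le_iff₀ hc).1 (Nat.ceil_le.1 hn)
  have h2 : (0 : ℝ) ≤ n := n.cast_nonneg
  nlinarith

theorem tendsto_natCast_sq : Tendsto (fun n : ℕ => (n : ℝ) ^ 2) atTop atTop :=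
  (tendsto_pow_atTop two_ne_zero).comp tendsto_natCast_atTop_atTop

theorem exists_separates_empty : ∃ P : Profile, P.Separates ∅ := by
  refine ⟨ofExponents (fun n => n) (fun n => (n : ℝ) ^ 2) (fun n => n.cast_nonneg)
    tendsto_natCast_sq, separates_ofExponents tendsto_natCast_atTop_atTop ?_
    (fun q hq => absurd hq (Set.notMem_empty q)) fun q _ _ => ?_⟩
  · filter_upwards [eventually_mul_le_mul_sq 1 one_pos] with n hn
    linarith
  · filter_upwards [eventually_mul_le_mul_sq (q + 1) one_pos] with n hn
    linarith

theorem exists_separates_Ici {r : ℝ} (hr : 1 ≤ r) : ∃ P : Profile, P.Separates (Set.Ici r) := by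
  rcases hr.eq_or_lt with rfl | hr
  -- All exponents are good if the upper atoms have no mass.
  · refine ⟨⟨fun n => (1 / 2) ^ n, 0, fun n => by positivity,
      tendsto_pow_atTop_nhds_zero_of_lt_one (by norm_num) (by norm_num), fun _ => le_rfl,
      fun _ => zero_le_one⟩, by simp, tendsto_const_nhds, fun q hq =>
      ⟨fun _ => Eventually.of_forall fun n => ?_, fun h => absurd hq h⟩⟩
    simp [Real.zero_rpow (show q ≠ 0 by linarith)]
  · have hb : Tendsto (fun n : ℕ => (r - 1) * (n : ℝ) ^ 2) atTop atTop :=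
      tendsto_natCast_sq.const_mul_atTop (by linarith)
    refine ⟨ofExponents (fun n => (n : ℝ) ^ 2) _ (fun n => by positivity) hb,
      separates_ofExponents tendsto_natCast_sq ?_ (fun q hq _ => Eventually.of_forall fun n => ?_)
        fun q hq _ => ?_⟩
    · filter_upwards [eventually_mul_le_mul_sq 2 (show 0 < r by linarith)] with n hn
      linarith
    · have hq' : r ≤ q := hq
      nlinarith [sq_nonneg (n : ℝ)]
    · have hq' : q < r := not_le.1 hq
      filter_upwards [eventually_mul_le_mul_sq 2 (sub_pos.2 hq')] with n hn
      linarith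

theorem exists_separates_Ioi {r : ℝ} (hr : 1 ≤ r) : ∃ P : Profile, P.Separates (Set.Ioi r) := by
  have hb : Tendsto (fun n : ℕ => (r - 1) * (n : ℝ) ^ 2 + 2 * n) atTop atTop :=
    tendsto_atTop_mono
      (fun n => le_add_of_nonneg_left (mul_nonneg (sub_nonneg.2 hr) (sq_nonneg (n : ℝ))))
      (tendsto_natCast_atTop_atTop.const_mul_atTop two_pos)
  refine ⟨ofExponents (fun n => (n : ℝ) ^ 2) _ (fun n => by positivity) hb,
    separates_ofExponents tendsto_natCast_sq (Eventually.of_forall fun n => ?_)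
      (fun q hq _ => ?_) fun q hq _ => Eventually.of_forall fun n => ?_⟩
  · nlinarith [sq_nonneg (n : ℝ)]
  · filter_upwards [eventually_mul_le_mul_sq 2 (sub_pos.2 (show r < q from hq))] with n hn
    linarith
  · have hq' : q ≤ r := not_lt.1 hq
    nlinarith [sq_nonneg (n : ℝ)]

end Profile

theorem diff_lebesgueModel {P : Profile} {G : Set ℝ} (h : P.Separates G) :
    (lebesgueModel P).basis.diff = {p | 1 ≤ p ∧ (p = ∞ ∨ p.toReal ∈ G)} := by
  obtain ⟨hs, ht, hG⟩ := h
  ext p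
  refine and_congr_right fun hp => ?_
  by_cases hpt : p = ∞
  · exact iff_of_true (lebesgueModel_differentiates P hs ht hp fun h => absurd hpt h) (Or.inl hpt)
  · have hq := hG p.toReal ((ENNReal.toReal_mono hpt hp).trans_eq' ENNReal.toReal_one.symm)
    by_cases hpG : p.toReal ∈ G
    · exact iff_of_true (lebesgueModel_differentiates P hs ht hp fun _ => hq.1 hpG) (Or.inr hpG)
    · refine iff_of_false ?_ (by tauto)
      exact (lebesgueModel P).not_differentiates_of_summable hp hpt (hq.2 hpG).1 (hq.2 hpG).2

theorem diff_discreteModel {P : Profile} {G : Set ℝ} (h : P.Separates G) :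
    (discreteModel P).basis.diff = {p | 1 ≤ p ∧ p ≠ ∞ ∧ p.toReal ∈ G} := by
  obtain ⟨-, ht, hG⟩ := h
  ext p
  refine and_congr_right fun hp => ?_
  by_cases hpt : p = ∞
  · subst hpt
    exact iff_of_false (discreteModel_not_differentiates_top P) (by tauto)
  · have hq := hG p.toReal ((ENNReal.toReal_mono hpt hp).trans_eq' ENNReal.toReal_one.symm)
    by_cases hpG : p.toReal ∈ G
    · exact iff_of_true (discreteModel_differentiates P ht hp hpt (hq.1 hpG)) ⟨hpt, hpG⟩
    · refine iff_of_false ?_ (by tauto)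
      exact (discreteModel P).not_differentiates_of_summable hp hpt (hq.2 hpG).1 (hq.2 hpG).2

/-- If the upper atoms carry half of the mass of each cell, their indicator function, which is
bounded, is not differentiated. -/
theorem exists_diff_eq_empty : ∃ P : Profile,
    (lebesgueModel P).measure Set.univ < ∞ ∧ (lebesgueModel P).basis.diff = ∅ := by
  have hb : Tendsto (fun n : ℕ => 2 * (n : ℝ)) atTop atTop :=
    tendsto_natCast_atTop_atTop.const_mul_atTop two_pos
  set P := Profile.ofExponents (fun _ => 0) _ (fun _ => le_rfl) hb
  have hfin := lebesgueModel_measure_univ_lt_top P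
    (Profile.summable_ofExponents (Eventually.of_forall fun n => by linarith))
  refine ⟨P, hfin, Set.eq_empty_of_forall_notMem fun p hp => ?_⟩
  refine (lebesgueModel P).not_differentiates_of_t_eq_one hp.1 (fun n => ?_) hfin hp.2
  change (2 : ℝ) ^ (-(0 : ℝ)) = 1
  simp

theorem exists_diff_eq_of_hasOneOfFirstFourForms {p₀ : ℝ≥0∞} {D : Set ℝ≥0∞} (h1 : 1 ≤ p₀)
    (ht : p₀ < ∞) (hD : HasOneOfFirstFourForms p₀ D) : ∃ P : Profile,
      (lebesgueModel P).measure Set.univ < ∞ ∧ (lebesgueModel P).basis.diff = D := by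
  have hr : 1 ≤ p₀.toReal := (ENNReal.toReal_mono ht.ne h1).trans_eq' ENNReal.toReal_one.symm
  rcases hD with rfl | rfl | rfl | rfl
  · exact exists_diff_eq_empty
  · obtain ⟨P, hP⟩ := Profile.exists_separates_empty
    refine ⟨P, lebesgueModel_measure_univ_lt_top P hP.1, (diff_lebesgueModel hP).trans ?_⟩
    ext p
    simp +contextual
  · obtain ⟨P, hP⟩ := Profile.exists_separates_Ici hr
    refine ⟨P, lebesgueModel_measure_univ_lt_top P hP.1, (diff_lebesgueModel hP).trans ?_⟩
    ext p
    rcases eq_or_ne p ∞ with rfl | hp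
    · simp
    · simp only [Set.mem_ofPred_eq, hp, false_or, Set.mem_Ici, Set.mem_Icc, le_top, and_true,
        ENNReal.toReal_le_toReal ht.ne hp]
      exact and_iff_right_of_imp h1.trans
  · obtain ⟨P, hP⟩ := Profile.exists_separates_Ioi hr
    refine ⟨P, lebesgueModel_measure_univ_lt_top P hP.1, (diff_lebesgueModel hP).trans ?_⟩
    ext p
    rcases eq_or_ne p ∞ with rfl | hp
    · simp [ht]
    · simp only [Set.mem_ofPred_eq, hp, false_or, Set.mem_Ioi, Set.mem_Ioc, le_top, and_true,
        ENNReal.toReal_lt_toReal ht.ne hp]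
      exact and_iff_right_of_imp fun h => h1.trans h.le

theorem exists_diff_eq_Ico {p₀ : ℝ≥0∞} (h1 : 1 ≤ p₀) (ht : p₀ < ∞) :
    ∃ P : Profile, (discreteModel P).basis.diff = Set.Ico p₀ ∞ := by
  obtain ⟨P, hP⟩ := Profile.exists_separates_Ici
    ((ENNReal.toReal_mono ht.ne h1).trans_eq' ENNReal.toReal_one.symm)
  refine ⟨P, (diff_discreteModel hP).trans (Set.ext fun p => ?_)⟩
  rcases eq_or_ne p ∞ with rfl | hp
  · simp
  · simp only [Set.mem_ofPred_eq, ne_eq, hp, not_false_eq_true, true_and, Set.mem_Ici, Set.mem_Ico,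
      lt_top_iff_ne_top, and_true, ENNReal.toReal_le_toReal ht.ne hp]
    exact and_iff_right_of_imp h1.trans

theorem exists_diff_eq_Ioo {p₀ : ℝ≥0∞} (h1 : 1 ≤ p₀) (ht : p₀ < ∞) :
    ∃ P : Profile, (discreteModel P).basis.diff = Set.Ioo p₀ ∞ := by
  obtain ⟨P, hP⟩ := Profile.exists_separates_Ioi
    ((ENNReal.toReal_mono ht.ne h1).trans_eq' ENNReal.toReal_one.symm)
  refine ⟨P, (diff_discreteModel hP).trans (Set.ext fun p => ?_)⟩
  rcases eq_or_ne p ∞ with rfl | hp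
  · simp
  · simp only [Set.mem_ofPred_eq, ne_eq, hp, not_false_eq_true, true_and, Set.mem_Ioi, Set.mem_Ioo,
      lt_top_iff_ne_top, and_true, ENNReal.toReal_lt_toReal ht.ne hp]
    exact and_iff_right_of_imp fun h => h1.trans h.le

theorem theorem1p3 :
    -- complete spaces: one of the six forms
    (∀ (X : Type u) [Nonempty X] [MetricSpace X] [MeasurableSpace X] [OpensMeasurableSpace X]
        (μ : Measure X) (B : DifferentiationBasis μ), μ.IsComplete →
        ∃ p₀ : ℝ≥0∞, 1 ≤ p₀ ∧ p₀ < ∞ ∧ HasOneOfSixForms p₀ B.diff) ∧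
    -- countable unions of open sets of finite measure, complete or not: one of the first four
    (∀ (X : Type u) [Nonempty X] [MetricSpace X] [MeasurableSpace X] [OpensMeasurableSpace X]
        (μ : Measure X) (B : DifferentiationBasis μ),
        (∃ G : ℕ → Set X, (∀ n, IsOpen (G n) ∧ μ (G n) < ∞) ∧ ⋃ n, G n = Set.univ) →
        ∃ p₀ : ℝ≥0∞, 1 ≤ p₀ ∧ p₀ < ∞ ∧ HasOneOfFirstFourForms p₀ B.diff) ∧
    -- all six forms are realized by complete spaces
    (∀ (p₀ : ℝ≥0∞) (P : Set ℝ≥0∞), 1 ≤ p₀ → p₀ < ∞ → HasOneOfSixForms p₀ P →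
        ∃ (X : Type) (_ : Nonempty X) (_ : MetricSpace X) (_ : MeasurableSpace X)
          (_ : OpensMeasurableSpace X) (μ : Measure X) (B : DifferentiationBasis μ),
          μ.IsComplete ∧ B.diff = P) ∧
    -- the first four forms are realized by complete spaces of finite measure
    (∀ (p₀ : ℝ≥0∞) (P : Set ℝ≥0∞), 1 ≤ p₀ → p₀ < ∞ → HasOneOfFirstFourForms p₀ P →
        ∃ (X : Type) (_ : Nonempty X) (_ : MetricSpace X) (_ : MeasurableSpace X)
          (_ : OpensMeasurableSpace X) (μ : Measure X) (B : DifferentiationBasis μ),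
          μ.IsComplete ∧ μ Set.univ < ∞ ∧ B.diff = P) := by
  have hfinite : ∀ (p₀ : ℝ≥0∞) (D : Set ℝ≥0∞), 1 ≤ p₀ → p₀ < ∞ → HasOneOfFirstFourForms p₀ D →
      ∃ (X : Type) (_ : Nonempty X) (_ : MetricSpace X) (_ : MeasurableSpace X)
        (_ : OpensMeasurableSpace X) (μ : Measure X) (B : DifferentiationBasis μ),
        μ.IsComplete ∧ μ Set.univ < ∞ ∧ B.diff = D := by
    intro p₀ D h1 ht hD
    obtain ⟨P, hfin, hP⟩ := exists_diff_eq_of_hasOneOfFirstFourForms h1 ht hD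
    exact ⟨(lebesgueModel P).Plane, inferInstance, inferInstance, inferInstance, inferInstance,
      (lebesgueModel P).measure, (lebesgueModel P).basis, (lebesgueModel P).isComplete_measure,
      hfin, hP⟩
  have hdiscrete : ∀ P : Profile,
      ∃ (X : Type) (_ : Nonempty X) (_ : MetricSpace X) (_ : MeasurableSpace X)
        (_ : OpensMeasurableSpace X) (μ : Measure X) (B : DifferentiationBasis μ),
        μ.IsComplete ∧ B.diff = (discreteModel P).basis.diff := fun P =>
    ⟨(discreteModel P).Plane, inferInstance, inferInstance, inferInstance, inferInstance,
      (discreteModel P).measure, (discreteModel P).basis, (discreteModel P).isComplete_measure, rfl⟩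
  have hfour : ∀ (p₀ : ℝ≥0∞) (D : Set ℝ≥0∞), 1 ≤ p₀ → p₀ < ∞ → HasOneOfFirstFourForms p₀ D →
      ∃ (X : Type) (_ : Nonempty X) (_ : MetricSpace X) (_ : MeasurableSpace X)
        (_ : OpensMeasurableSpace X) (μ : Measure X) (B : DifferentiationBasis μ),
        μ.IsComplete ∧ B.diff = D := by
    intro p₀ D h1 ht hD
    obtain ⟨X, i₁, i₂, i₃, i₄, μ, B, hc, -, hB⟩ := hfinite p₀ D h1 ht hD
    exact ⟨X, i₁, i₂, i₃, i₄, μ, B, hc, hB⟩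
  refine ⟨fun X _ _ _ _ μ B hμ => ?_, fun X _ _ _ _ μ B ⟨G, hG, hcover⟩ => ?_,
    fun p₀ D h1 ht hD => ?_, hfinite⟩
  · exact exists_hasOneOfSixForms (fun p hp => hp.1)
      fun p hp q hpq hq => B.mem_diff_of_le_of_isComplete hμ hp hpq hq
  · exact exists_hasOneOfFirstFourForms (fun p hp => hp.1)
      fun p hp q hpq => B.mem_diff_of_le_of_cover hG hcover hp hpq
  · rcases hD with h | h | h | h | h | h
    · exact hfour p₀ D h1 ht (Or.inl h)
    · exact hfour p₀ D h1 ht (Or.inr (Or.inl h))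
    · exact hfour p₀ D h1 ht (Or.inr (Or.inr (Or.inl h)))
    · exact hfour p₀ D h1 ht (Or.inr (Or.inr (Or.inr h)))
    · obtain ⟨P, hP⟩ := exists_diff_eq_Ico h1 ht
      exact h ▸ hP ▸ hdiscrete P
    · obtain ⟨P, hP⟩ := exists_diff_eq_Ioo h1 ht
      exact h ▸ hP ▸ hdiscrete P
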